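/- Let $n\ge 1$, let $M$ be a (nonempty, Hausdorff, second countable) smooth $n$-dimensional manifold without boundary, let $X:M\to\mathbb R^{n+1}$ be a smooth immersion with a smooth unit normal vector field $N$ along $X$, and let $X_0\in\mathbb R^{n+1}$ and $t_0\in\mathbb R$, $t_0\neq 0$. Let $d\mu$ be the area element of $M$ in the metric induced by $X$ and $H=\sum_{i,j} g^{ij}h_{ij}$ the mean curvature, where $g_{ij}=\langle\partial_iX,\partial_jX\rangle$ and $h_{ij}=\langle\partial_i\partial_jX,N\rangle$. For $\lambda\in\mathbb R$, $X$ is called a $\lambda$-hypersurface if $\langle\frac{X-X_0}{t_0},N\rangle+H=\lambda$ on $M$. A normal variation of $X$ is a smooth family of immersions $X(t):M\to\mathbb R^{n+1}$, $t\in(-\varepsilon,\varepsilon)$, $\varepsilon>0$, with $X(0)=X$, with $X(t)=X$ outside a compact set $K\subset M$ independent of $t$, and with $\frac{\partial X(t)}{\partial t}|_{t=0}=fN$ for some function $f$ on $M$. With $d\mu_t$ the area element of $X(t)$, put $$A(t)=\int_K e^{-\frac{|X(t)-X_0|^2}{2t_0}}\,d\mu_t,\qquad V(t)=\int_K\langle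 X(t)-X_0,N\rangle e^{-\frac{|X-X_0|^2}{2t_0}}\,d\mu .$$ (Integrating over $M$ instead of $K$ changes $A$ and $V$ only by constants, when the integrals over $M$ are finite.) The variation is weighted-volume-preserving if $V(t)=V(0)$ for all $t\in(-\varepsilon,\varepsilon)$. $X$ is a critical point of the weighted area for all weighted-volume-preserving variations if, for every weighted-volume-preserving normal variation and every such $K$, $A$ is differentiable at $0$ with $A'(0)=0$. Let $\widetilde H$ be the mean curvature of $X$ in $\mathbb R^{n+1}$ with the conformal metric $g_{AB}=e^{-\frac{|x-X_0|^2}{nt_0}}\delta_{AB}$, with respect to the unit normal for this metric which is a positive multiple of $N$ (that is, the trace, for the induced metric, of the second fundamental form defined by the Levi-Civita connection of $g_{AB}$), and let $H_w=e^{-\frac{|X-X_0|^2}{2nt_0}}\widetilde H$ be the weighted mean curvature. **Theorem 2.1.** The following statements are equivalent: 1. $X$ is a $\lambda$-hypersurface for some constant $\lambda$; 2. $X$ is a critical point of the weighted area for all weighted-volume-preserving variations; 3. $X$ has constant weighted mean curvature $H_w=\lambda$ for some constant $\lambda$. Moreover, for each fixed $\lambda\in\mathbb R$, $X$ is a $\lambda$-hypersurface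 if and only if $H_w=\lambda$ on $M$; and if $X$ is a $\lambda$-hypersurface of finite weighted area $\int_M e^{-\frac{|X-X_0|^2}{2t_0}}d\mu$, then $$\lambda=\frac{\int_M\left(\langle\frac{X-X_0}{t_0},N\rangle+H\right)e^{-\frac{|X-X_0|^2}{2t_0}}d\mu}{\int_M e^{-\frac{|X-X_0|^2}{2t_0}}d\mu}.$$ -/

import Mathlib

open Set MeasureTheory
open scoped Manifold ContDiff RealInnerProductSpace

noncomputable section

namespace LambdaHypersurface

/-! ### Local differential geometry of a parametrized hypersurface

`Y : ℝⁿ → ℝⁿ⁺¹` is a local parametrization and `G` is a Riemannian metric on `ℝⁿ⁺¹`, given at each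
point `x` as a bilinear form `G x`. -/

/-- The `i`-th partial derivative of `Y` at `u`. -/
def partialDeriv {n : ℕ} {F : Type*} [NormedAddCommGroup F] [NormedSpace ℝ F]
    (Y : EuclideanSpace ℝ (Fin n) → F) (i : Fin n) (u : EuclideanSpace ℝ (Fin n)) : F :=
  fderiv ℝ Y u (EuclideanSpace.single i 1)

/-- The Euclidean metric `δ` of `ℝᵐ`. -/
def euclideanMetric {m : ℕ} (_x : EuclideanSpace ℝ (Fin m)) :
    EuclideanSpace ℝ (Fin m) →ₗ[ℝ] EuclideanSpace ℝ (Fin m) →ₗ[ℝ] ℝ :=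
  innerₗ (EuclideanSpace ℝ (Fin m))

/-- The conformal metric `exp (-|x - X₀|² / (n t₀)) δ` of `ℝⁿ⁺¹`. -/
def conformalMetric {n : ℕ} (X₀ : EuclideanSpace ℝ (Fin (n + 1))) (t₀ : ℝ)
    (x : EuclideanSpace ℝ (Fin (n + 1))) :
    EuclideanSpace ℝ (Fin (n + 1)) →ₗ[ℝ] EuclideanSpace ℝ (Fin (n + 1)) →ₗ[ℝ] ℝ :=
  Real.exp (-‖x - X₀‖ ^ 2 / (n * t₀)) • innerₗ (EuclideanSpace ℝ (Fin (n + 1)))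

/-- The Christoffel symbol of the first kind of the metric `G`: for vectors `a`, `b`, `c`, regarded
as constant vector fields on `ℝᵐ`, this is `G (∇ₐ b, c)` at `x`, where `∇` is the Levi-Civita
connection of `G` (Koszul formula). -/
def christoffel {m : ℕ}
    (G : EuclideanSpace ℝ (Fin m) →
      EuclideanSpace ℝ (Fin m) →ₗ[ℝ] EuclideanSpace ℝ (Fin m) →ₗ[ℝ] ℝ)
    (x a b c : EuclideanSpace ℝ (Fin m)) : ℝ :=
  (fderiv ℝ (fun y => G y b c) x a + fderiv ℝ (fun y => G y a c) x b
    - fderiv ℝ (fun y => G y a b) x c) / 2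

/-- The first fundamental form `g i j = G (∂ᵢ Y, ∂ⱼ Y)` at the parameter `u`. -/
def firstFundamentalForm {n m : ℕ}
    (G : EuclideanSpace ℝ (Fin m) →
      EuclideanSpace ℝ (Fin m) →ₗ[ℝ] EuclideanSpace ℝ (Fin m) →ₗ[ℝ] ℝ)
    (Y : EuclideanSpace ℝ (Fin n) → EuclideanSpace ℝ (Fin m)) (u : EuclideanSpace ℝ (Fin n)) :
    Matrix (Fin n) (Fin n) ℝ :=
  Matrix.of fun i j => G (Y u) (partialDeriv Y i u) (partialDeriv Y j u)

/-- The second fundamental form `h i j = G (∇_{∂ᵢ Y} ∂ⱼ Y, ν)` at the parameter `u`, with respect to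
the unit normal vector `ν` of `Y` at `u` and the Levi-Civita connection `∇` of `G`; the covariant
derivative `∇_{∂ᵢ Y} ∂ⱼ Y` along `Y` is `∂ᵢ ∂ⱼ Y` plus the Christoffel term. -/
def secondFundamentalForm {n m : ℕ}
    (G : EuclideanSpace ℝ (Fin m) →
      EuclideanSpace ℝ (Fin m) →ₗ[ℝ] EuclideanSpace ℝ (Fin m) →ₗ[ℝ] ℝ)
    (Y : EuclideanSpace ℝ (Fin n) → EuclideanSpace ℝ (Fin m)) (ν : EuclideanSpace ℝ (Fin m))
    (u : EuclideanSpace ℝ (Fin n)) : Matrix (Fin n) (Fin n) ℝ :=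
  Matrix.of fun i j =>
    G (Y u) (partialDeriv (partialDeriv Y j) i u) ν
      + christoffel G (Y u) (partialDeriv Y i u) (partialDeriv Y j u) ν

/-- The mean curvature of a parametrized hypersurface at the parameter `u`: the trace `g^{ij} h_{ij}`
of the second fundamental form with respect to the first. -/
def localMeanCurvature {n m : ℕ}
    (G : EuclideanSpace ℝ (Fin m) →
      EuclideanSpace ℝ (Fin m) →ₗ[ℝ] EuclideanSpace ℝ (Fin m) →ₗ[ℝ] ℝ)
    (Y : EuclideanSpace ℝ (Fin n) → EuclideanSpace ℝ (Fin m)) (ν : EuclideanSpace ℝ (Fin m))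
    (u : EuclideanSpace ℝ (Fin n)) : ℝ :=
  ((firstFundamentalForm G Y u)⁻¹ * secondFundamentalForm G Y ν u).trace

/-- The Euclidean area density `√(det g)` of a parametrized hypersurface. -/
def areaDensity {n m : ℕ} (Y : EuclideanSpace ℝ (Fin n) → EuclideanSpace ℝ (Fin m))
    (u : EuclideanSpace ℝ (Fin n)) : ℝ :=
  Real.sqrt (firstFundamentalForm euclideanMetric Y u).det

/-! ### Immersed hypersurfaces -/

section Hypersurface

variable {n : ℕ} {M : Type*} [TopologicalSpace M] [ChartedSpace (EuclideanSpace ℝ (Fin n)) M]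

/-- `X` written in the preferred chart of `M` around `p`. -/
def inChart (X : M → EuclideanSpace ℝ (Fin (n + 1))) (p : M) :
    EuclideanSpace ℝ (Fin n) → EuclideanSpace ℝ (Fin (n + 1)) :=
  X ∘ (extChartAt (𝓡 n) p).symm

/-- A smooth immersion of the `n`-manifold `M` into `ℝⁿ⁺¹`. -/
structure IsSmoothImmersion (X : M → EuclideanSpace ℝ (Fin (n + 1))) : Prop where
  contMDiff : ContMDiff (𝓡 n) 𝓘(ℝ, EuclideanSpace ℝ (Fin (n + 1))) ∞ X
  injective_mfderiv : ∀ p : M,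
    Function.Injective (mfderiv (𝓡 n) 𝓘(ℝ, EuclideanSpace ℝ (Fin (n + 1))) X p)

/-- `N` is a smooth (Euclidean) unit normal vector field along `X`. -/
structure IsUnitNormal (X N : M → EuclideanSpace ℝ (Fin (n + 1))) : Prop where
  contMDiff : ContMDiff (𝓡 n) 𝓘(ℝ, EuclideanSpace ℝ (Fin (n + 1))) ∞ N
  norm_eq_one : ∀ p : M, ‖N p‖ = 1
  orthogonal : ∀ (p : M) (v : TangentSpace (𝓡 n) p),
    innerₗ (EuclideanSpace ℝ (Fin (n + 1)))
      (mfderiv (𝓡 n) 𝓘(ℝ, EuclideanSpace ℝ (Fin (n + 1))) X p v) (N p) = 0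

/-- The mean curvature at `p` of the hypersurface `X` in `(ℝⁿ⁺¹, G)` with respect to the `G`-unit
normal vector field `ν`. -/
def meanCurvature
    (G : EuclideanSpace ℝ (Fin (n + 1)) →
      EuclideanSpace ℝ (Fin (n + 1)) →ₗ[ℝ] EuclideanSpace ℝ (Fin (n + 1)) →ₗ[ℝ] ℝ)
    (X ν : M → EuclideanSpace ℝ (Fin (n + 1))) (p : M) : ℝ :=
  localMeanCurvature G (inChart X p) (ν p) (extChartAt (𝓡 n) p p)

/-- The vector field `N` along `X`, rescaled to unit length for the metric `G`. -/
def normalizeField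
    (G : EuclideanSpace ℝ (Fin (n + 1)) →
      EuclideanSpace ℝ (Fin (n + 1)) →ₗ[ℝ] EuclideanSpace ℝ (Fin (n + 1)) →ₗ[ℝ] ℝ)
    (X N : M → EuclideanSpace ℝ (Fin (n + 1))) (p : M) : EuclideanSpace ℝ (Fin (n + 1)) :=
  (Real.sqrt (G (X p) (N p) (N p)))⁻¹ • N p

/-- The weighted mean curvature `exp (-|X - X₀|² / (2 n t₀)) * H`, where `H` is the mean
curvature of `X` in `ℝⁿ⁺¹` with respect to the conformal metric `exp (-|x - X₀|² / (n t₀)) δ`. -/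
def weightedMeanCurvature (X₀ : EuclideanSpace ℝ (Fin (n + 1))) (t₀ : ℝ)
    (X N : M → EuclideanSpace ℝ (Fin (n + 1))) (p : M) : ℝ :=
  Real.exp (-‖X p - X₀‖ ^ 2 / (2 * n * t₀)) *
    meanCurvature (conformalMetric X₀ t₀) X (normalizeField (conformalMetric X₀ t₀) X N) p

/-- The function `⟪(X - X₀) / t₀, N⟫ + H`, with `H` the Euclidean mean curvature. -/
def lambdaFunction (X₀ : EuclideanSpace ℝ (Fin (n + 1))) (t₀ : ℝ)
    (X N : M → EuclideanSpace ℝ (Fin (n + 1))) (p : M) : ℝ :=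
  ⟪t₀⁻¹ • (X p - X₀), N p⟫ + meanCurvature euclideanMetric X N p

/-- `X` is a `lam`-hypersurface. -/
def IsLambdaHypersurface (X₀ : EuclideanSpace ℝ (Fin (n + 1))) (t₀ lam : ℝ)
    (X N : M → EuclideanSpace ℝ (Fin (n + 1))) : Prop :=
  ∀ p : M, lambdaFunction X₀ t₀ X N p = lam

/-- `X` has constant weighted mean curvature `lam`. -/
def HasConstantWeightedMeanCurvature (X₀ : EuclideanSpace ℝ (Fin (n + 1))) (t₀ lam : ℝ)
    (X N : M → EuclideanSpace ℝ (Fin (n + 1))) : Prop :=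
  ∀ p : M, weightedMeanCurvature X₀ t₀ X N p = lam

variable [MeasurableSpace M]

/-- The area measure on the domain of the chart at `p`: Lebesgue measure with density `√(det g)` on
the target of the chart, transported to `M`. -/
def chartAreaMeasure (X : M → EuclideanSpace ℝ (Fin (n + 1))) (p : M) : Measure M :=
  ((volume.restrict (extChartAt (𝓡 n) p).target).withDensity
    fun u => ENNReal.ofReal (areaDensity (inChart X p) u)).map (extChartAt (𝓡 n) p).symm

/-- The area measure of `M` in the metric induced by `X`. The measures of the various charts agree
on overlaps, by the change of variables formula, so that their supremum in the complete lattice of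
measures is (for a second countable manifold) the unique measure which restricts to each of them on
the domain of the chart. -/
def areaMeasure (X : M → EuclideanSpace ℝ (Fin (n + 1))) : Measure M :=
  ⨆ p : M, chartAreaMeasure X p

/-- The weighted area `∫_K exp (-|Y - X₀|² / (2 t₀)) dμ_Y` of the part `K` of the immersed
hypersurface `Y`. -/
def weightedArea (X₀ : EuclideanSpace ℝ (Fin (n + 1))) (t₀ : ℝ)
    (Y : M → EuclideanSpace ℝ (Fin (n + 1))) (K : Set M) : ℝ :=
  ∫ p in K, Real.exp (-‖Y p - X₀‖ ^ 2 / (2 * t₀)) ∂(areaMeasure Y)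

/-- The weighted volume `∫_K ⟪Y - X₀, N⟫ exp (-|X - X₀|² / (2 t₀)) dμ_X` of `Y`, relative to the
hypersurface `X` with unit normal `N`, over the part `K`. -/
def weightedVolume (X₀ : EuclideanSpace ℝ (Fin (n + 1))) (t₀ : ℝ)
    (X N Y : M → EuclideanSpace ℝ (Fin (n + 1))) (K : Set M) : ℝ :=
  ∫ p in K, ⟪Y p - X₀, N p⟫ * Real.exp (-‖X p - X₀‖ ^ 2 / (2 * t₀)) ∂(areaMeasure X)

/-- `F t`, for `|t| < ε`, is a smooth variation of `X` through immersions, which is constant outside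
the compact set `K` and whose variation vector field at `t = 0` is normal. -/
structure IsNormalVariation (X N : M → EuclideanSpace ℝ (Fin (n + 1))) (ε : ℝ) (K : Set M)
    (F : ℝ → M → EuclideanSpace ℝ (Fin (n + 1))) : Prop where
  pos : 0 < ε
  contMDiffOn : ContMDiffOn (𝓘(ℝ, ℝ).prod (𝓡 n)) 𝓘(ℝ, EuclideanSpace ℝ (Fin (n + 1))) ∞
    (fun q : ℝ × M => F q.1 q.2) (Ioo (-ε) ε ×ˢ univ)
  immersion : ∀ t ∈ Ioo (-ε) ε, IsSmoothImmersion (F t)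
  initial : F 0 = X
  isCompact : IsCompact K
  eq_of_notMem : ∀ t ∈ Ioo (-ε) ε, ∀ p ∉ K, F t p = X p
  normal : ∃ f : M → ℝ, ∀ p : M, deriv (fun t => F t p) 0 = f p • N p

/-- The variation `F` (constant outside `K`) preserves the weighted volume. -/
def PreservesWeightedVolume (X₀ : EuclideanSpace ℝ (Fin (n + 1))) (t₀ : ℝ)
    (X N : M → EuclideanSpace ℝ (Fin (n + 1))) (ε : ℝ) (K : Set M)
    (F : ℝ → M → EuclideanSpace ℝ (Fin (n + 1))) : Prop :=
  ∀ t ∈ Ioo (-ε) ε, weightedVolume X₀ t₀ X N (F t) K = weightedVolume X₀ t₀ X N (F 0) K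

/-- `X` is a critical point of the weighted area for all weighted-volume-preserving (compactly
supported, normal) variations. The area is taken over a compact set outside which the variation is
constant, so that it is finite; if the total area is finite, this changes it only by a constant. -/
def IsCriticalForWeightedArea (X₀ : EuclideanSpace ℝ (Fin (n + 1))) (t₀ : ℝ)
    (X N : M → EuclideanSpace ℝ (Fin (n + 1))) : Prop :=
  ∀ (ε : ℝ) (K : Set M) (F : ℝ → M → EuclideanSpace ℝ (Fin (n + 1))),
    IsNormalVariation X N ε K F → PreservesWeightedVolume X₀ t₀ X N ε K F →
      HasDerivAt (fun t => weightedArea X₀ t₀ (F t) K) 0 0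

end Hypersurface

end LambdaHypersurface

end

/-! Write w = exp(-|X - X₀|²/(2t₀)) and Λ = ⟨(X - X₀)/t₀, N⟩ + H. Everything rests on one pointwise
identity and two first variation formulas.

The identity is H_w = Λ (`weightedMeanCurvature_eq_lambdaFunction`). For the conformal metric
e^{2φ}δ with φ = -|x - X₀|²/(2nt₀), the second fundamental form gains the term -⟨∇φ, N⟩g. Its trace
is n times ⟨X - X₀, N⟩/(nt₀), which is the first summand of Λ. The remaining factor e^{-φ}, from
normalizing N, is cancelled by the weight in H_w. This settles the equivalence with constant
weighted mean curvature for each fixed λ.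

For a normal variation with speed f, the formulas are A'(0) = -∫ fΛw dμ and V'(0) = ∫ fw dμ
(`hasDerivAt_weightedArea`, `hasDerivAt_weightedVolume`). If Λ = λ, then A'(0) = -λV'(0), which
vanishes when V is preserved. Conversely, V is affine in the varied map, because N, w and dμ are
frozen. So if ∫ fw dμ = 0 and f has compact support, the variation X + tfN preserves V exactly and
no correction of the family is needed. Criticality then gives ∫ fΛw dμ = 0 for all such f.
Subtracting a multiple of a fixed bump function removes the constraint, and the fundamental lemma of
the calculus of variations makes Λ constant.

The analytic work is to bring all the areas A(t) to the fixed measure dμ: the area measure of X(t)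
has a density `areaRatio` with respect to dμ, smooth in (t, p), so one can differentiate under the
integral sign over K. Its derivative at t = 0 is -fH (`hasDerivAt_areaRatio`), by Jacobi's formula.
-/

noncomputable section

namespace LambdaHypersurface

/-! ### Gram matrices of linear maps -/

section Gram

variable {n m : ℕ}

/-- The Gram matrix of the images of the standard basis vectors under `L`. -/
def gramMatrix (L : EuclideanSpace ℝ (Fin n) →L[ℝ] EuclideanSpace ℝ (Fin m)) :
    Matrix (Fin n) (Fin n) ℝ :=
  Matrix.gram ℝ fun i => L (EuclideanSpace.single i 1)

lemma gramMatrix_apply (L : EuclideanSpace ℝ (Fin n) →L[ℝ] EuclideanSpace ℝ (Fin m))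
    (i j : Fin n) :
    gramMatrix L i j = ⟪L (EuclideanSpace.single i 1), L (EuclideanSpace.single j 1)⟫ := rfl

lemma firstFundamentalForm_euclideanMetric
    (Y : EuclideanSpace ℝ (Fin n) → EuclideanSpace ℝ (Fin m)) (u : EuclideanSpace ℝ (Fin n)) :
    firstFundamentalForm euclideanMetric Y u = gramMatrix (fderiv ℝ Y u) := rfl

lemma areaDensity_eq (Y : EuclideanSpace ℝ (Fin n) → EuclideanSpace ℝ (Fin m))
    (u : EuclideanSpace ℝ (Fin n)) :
    areaDensity Y u = √(gramMatrix (fderiv ℝ Y u)).det := rfl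

lemma gramMatrix_transpose (L : EuclideanSpace ℝ (Fin n) →L[ℝ] EuclideanSpace ℝ (Fin m)) :
    (gramMatrix L).transpose = gramMatrix L := by
  ext i j
  simp only [Matrix.transpose_apply, gramMatrix_apply]
  exact real_inner_comm _ _

/-- If T is the matrix of A, the Gram matrix becomes TᵀGT. This is the transformation law of the
area density under a change of chart. -/
lemma gramMatrix_comp (L : EuclideanSpace ℝ (Fin n) →L[ℝ] EuclideanSpace ℝ (Fin m))
    (A : EuclideanSpace ℝ (Fin n) →L[ℝ] EuclideanSpace ℝ (Fin n)) :
    (gramMatrix (L.comp A)).det = A.det ^ 2 * (gramMatrix L).det := by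
  obtain ⟨b, hbe⟩ : ∃ b : Module.Basis (Fin n) ℝ (EuclideanSpace ℝ (Fin n)),
      ∀ i, b i = EuclideanSpace.single i 1 :=
    ⟨(EuclideanSpace.basisFun (Fin n) ℝ).toBasis, fun i => by simp⟩
  obtain ⟨T, hT⟩ : ∃ T : Matrix (Fin n) (Fin n) ℝ, T = LinearMap.toMatrix b b A.toLinearMap :=
    ⟨_, rfl⟩
  have hA : ∀ i, A (EuclideanSpace.single i 1) = ∑ k, T k i • EuclideanSpace.single k (1 : ℝ) := by
    intro i
    have := b.sum_repr (A (b i))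
    rw [← hbe i, ← this]
    refine Finset.sum_congr rfl fun k _ => ?_
    rw [hT, LinearMap.toMatrix_apply, hbe k]; simp
  have h : gramMatrix (L.comp A) = T.transpose * gramMatrix L * T := by
    ext i j
    simp only [gramMatrix_apply, ContinuousLinearMap.comp_apply, hA, map_sum, map_smul, sum_inner,
      inner_sum, inner_smul_left, inner_smul_right, Matrix.mul_apply, Matrix.transpose_apply,
      Finset.sum_mul]
    refine Finset.sum_congr rfl fun k _ => ?_
    rw [Finset.mul_sum]
    refine Finset.sum_congr rfl fun l _ => ?_
    simp only [conj_trivial]; ring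
  have hdet : T.det = A.det := by rw [hT, LinearMap.det_toMatrix]
  rw [h, Matrix.det_mul, Matrix.det_mul, Matrix.det_transpose, hdet]
  ring

lemma gramMatrix_det_nonneg (L : EuclideanSpace ℝ (Fin n) →L[ℝ] EuclideanSpace ℝ (Fin m)) :
    0 ≤ (gramMatrix L).det :=
  (Matrix.posSemidef_gram ℝ _).det_nonneg

/-- A Gram matrix is positive semidefinite, and definite exactly when the vectors are independent.
Being an immersion thus becomes positivity of a continuous function. -/
lemma gramMatrix_det_pos_iff (L : EuclideanSpace ℝ (Fin n) →L[ℝ] EuclideanSpace ℝ (Fin m)) :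
    0 < (gramMatrix L).det ↔ Function.Injective L := by
  have h1 : 0 < (gramMatrix L).det ↔ (gramMatrix L).det ≠ 0 :=
    ⟨fun h => h.ne', fun h => (gramMatrix_det_nonneg L).lt_of_ne' h⟩
  rw [h1, gramMatrix, ← (Matrix.posSemidef_gram ℝ _).posDef_iff_det_ne_zero,
    Matrix.posDef_gram_iff_linearIndependent]
  set b := (EuclideanSpace.basisFun (Fin n) ℝ).toBasis with hb
  have hbe : (fun i => L (EuclideanSpace.single i 1)) = L.toLinearMap ∘ b := by
    ext i; simp [hb]
  rw [hbe]
  constructor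
  · intro h
    have e : b.constr ℝ (L.toLinearMap ∘ b) = L.toLinearMap := b.constr_eq ℝ fun i => rfl
    have := b.injective_constr_of_linearIndependent (R₂ := ℝ) h
    rwa [e] at this
  · intro h
    exact b.linearIndependent.map' _ (LinearMap.ker_eq_bot.2 h)

/-- **Jacobi's formula** for the derivative of the determinant. -/
lemma hasDerivAt_det {A : ℝ → Matrix (Fin n) (Fin n) ℝ} {A' : Matrix (Fin n) (Fin n) ℝ} {t : ℝ}
    (hA : ∀ i j, HasDerivAt (fun s => A s i j) (A' i j) t) :
    HasDerivAt (fun s => (A s).det) ((A t).adjugate * A').trace t := by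
  -- As a multilinear function of the rows, the determinant has as derivative a sum over i of
  -- determinants with row i replaced; Cramer's rule turns these into adjugate entries.
  let D : ContinuousMultilinearMap ℝ (fun _ : Fin n => Fin n → ℝ) ℝ :=
    ⟨(Matrix.detRowAlternating (n := Fin n) (R := ℝ)).toMultilinearMap,
      Continuous.matrix_det continuous_id⟩
  have hA₀ : HasDerivAt (fun s i => A s i) (fun i => A' i) t :=
    hasDerivAt_pi.2 fun i => hasDerivAt_pi.2 fun j => hA i j
  have h := (D.hasFDerivAt (fun i => A t i)).comp_hasDerivAt t hA₀
  refine h.congr_deriv ?_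
  rw [ContinuousMultilinearMap.linearDeriv_apply, Matrix.trace_mul_comm, Matrix.trace]
  refine Finset.sum_congr rfl fun i _ => ?_
  change ((A t).updateRow i (A' i)).det = _
  rw [← Matrix.cramer_transpose_apply, Matrix.cramer_eq_adjugate_mulVec, Matrix.diag_apply,
    Matrix.mul_apply, Matrix.mulVec, dotProduct]
  refine Finset.sum_congr rfl fun j _ => ?_
  rw [← Matrix.adjugate_transpose, Matrix.transpose_apply, mul_comm]

end Gram

/-! ### Mean curvature in the conformal metric -/

section Conformal

variable {n m : ℕ}

lemma christoffel_euclideanMetric (x a b c : EuclideanSpace ℝ (Fin m)) :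
    christoffel euclideanMetric x a b c = 0 := by
  simp [christoffel, euclideanMetric]

lemma secondFundamentalForm_euclideanMetric
    (Y : EuclideanSpace ℝ (Fin n) → EuclideanSpace ℝ (Fin m)) (ν : EuclideanSpace ℝ (Fin m))
    (u : EuclideanSpace ℝ (Fin n)) :
    secondFundamentalForm euclideanMetric Y ν u =
      Matrix.of fun i j => ⟪partialDeriv (partialDeriv Y j) i u, ν⟫ := by
  ext i j
  simp [secondFundamentalForm, christoffel_euclideanMetric, euclideanMetric]

lemma conformalMetric_apply (X₀ : EuclideanSpace ℝ (Fin (n + 1))) (t₀ : ℝ)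
    (x b c : EuclideanSpace ℝ (Fin (n + 1))) :
    conformalMetric X₀ t₀ x b c = Real.exp (-‖x - X₀‖ ^ 2 / (n * t₀)) * ⟪b, c⟫ := by
  simp [conformalMetric]

lemma fderiv_conformalMetric (X₀ : EuclideanSpace ℝ (Fin (n + 1))) (t₀ : ℝ)
    (x a b c : EuclideanSpace ℝ (Fin (n + 1))) :
    fderiv ℝ (fun y => conformalMetric X₀ t₀ y b c) x a =
      Real.exp (-‖x - X₀‖ ^ 2 / (n * t₀)) * (-(2 * ⟪x - X₀, a⟫) / (n * t₀)) * ⟪b, c⟫ := by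
  simp only [conformalMetric_apply]
  have h1 : HasFDerivAt (fun y : EuclideanSpace ℝ (Fin (n + 1)) => ‖y - X₀‖ ^ 2)
      (2 • (innerSL ℝ (x - X₀))) x := by
    simpa using ((hasFDerivAt_id x).sub_const X₀).norm_sq
  have h2 := (((h1.fun_neg.mul_const (n * t₀)⁻¹).exp).mul_const ⟪b, c⟫).fderiv
  simp only [← div_eq_mul_inv] at h2
  rw [h2]
  simp [inner_sub_left]
  ring

/-- Differentiating the metric only rescales inner products, so the two Koszul terms containing ⟨a,
c⟩ or ⟨b, c⟩ vanish for normal c. -/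
lemma christoffel_conformalMetric (X₀ : EuclideanSpace ℝ (Fin (n + 1))) (t₀ : ℝ)
    (x a b c : EuclideanSpace ℝ (Fin (n + 1))) (ha : ⟪a, c⟫ = 0) (hb : ⟪b, c⟫ = 0) :
    christoffel (conformalMetric X₀ t₀) x a b c =
      Real.exp (-‖x - X₀‖ ^ 2 / (n * t₀)) * (⟪x - X₀, c⟫ / (n * t₀)) * ⟪a, b⟫ := by
  rw [christoffel, fderiv_conformalMetric, fderiv_conformalMetric, fderiv_conformalMetric, ha, hb]
  ring

/-- The mean curvature of a hypersurface with respect to the conformal metric, in terms of the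
Euclidean one. -/
lemma localMeanCurvature_conformalMetric (hn : n ≠ 0)
    (X₀ : EuclideanSpace ℝ (Fin (n + 1))) (t₀ s : ℝ)
    (Y : EuclideanSpace ℝ (Fin n) → EuclideanSpace ℝ (Fin (n + 1)))
    (u : EuclideanSpace ℝ (Fin n)) (ν : EuclideanSpace ℝ (Fin (n + 1)))
    (hν : ∀ v, ⟪fderiv ℝ Y u v, ν⟫ = 0) (hY : Function.Injective (fderiv ℝ Y u)) :
    localMeanCurvature (conformalMetric X₀ t₀) Y (s • ν) u =
      s * (⟪t₀⁻¹ • (Y u - X₀), ν⟫ + localMeanCurvature euclideanMetric Y ν u) := by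
  have hdet := ((gramMatrix_det_pos_iff _).2 hY).ne'
  set e := Real.exp (-‖Y u - X₀‖ ^ 2 / (n * t₀)) with he
  have he0 : e ≠ 0 := (Real.exp_pos _).ne'
  set g := gramMatrix (fderiv ℝ Y u) with hg
  set h := secondFundamentalForm euclideanMetric Y ν u with hh
  have h1 : firstFundamentalForm (conformalMetric X₀ t₀) Y u = e • g := by
    ext i j
    simp [firstFundamentalForm, conformalMetric_apply, he, hg, gramMatrix_apply, partialDeriv]
  have h2 : secondFundamentalForm (conformalMetric X₀ t₀) Y (s • ν) u =
      (e * s) • (h + (⟪Y u - X₀, ν⟫ / (n * t₀)) • g) := by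
    ext i j
    rw [hh, secondFundamentalForm_euclideanMetric, secondFundamentalForm, Matrix.of_apply,
      christoffel_conformalMetric _ _ _ _ _ _ (by simp [partialDeriv, inner_smul_right, hν])
        (by simp [partialDeriv, inner_smul_right, hν]), conformalMetric_apply]
    simp [inner_smul_right, hg, gramMatrix_apply, partialDeriv, ← he]
    ring
  have h3 : (e • g)⁻¹ = e⁻¹ • g⁻¹ := by
    refine Matrix.inv_eq_left_inv ?_
    rw [smul_mul_smul_comm, inv_mul_cancel₀ he0, Matrix.nonsing_inv_mul _ (Ne.isUnit hdet),
      one_smul]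
  rw [localMeanCurvature, localMeanCurvature, h1, h2, h3, firstFundamentalForm_euclideanMetric,
    ← hg, ← hh, smul_mul_smul_comm, mul_add, mul_smul_comm,
    Matrix.nonsing_inv_mul _ (Ne.isUnit hdet)]
  -- The trace of the identity is n, which cancels the n in the exponent of the conformal factor.
  have hn' : (n : ℝ) ≠ 0 := Nat.cast_ne_zero.2 hn
  simp only [Matrix.trace_smul, Matrix.trace_add, Matrix.trace_one, Fintype.card_fin, smul_eq_mul,
    inner_smul_left, conj_trivial]
  field_simp
  ring

end Conformal

/-! ### Weighted mean curvature on the manifold -/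

section Hypersurface

variable {n : ℕ} {M : Type*} [TopologicalSpace M] [ChartedSpace (EuclideanSpace ℝ (Fin n)) M]

lemma fderiv_inChart (X : M → EuclideanSpace ℝ (Fin (n + 1))) (p : M)
    (hX : MDifferentiableAt (𝓡 n) 𝓘(ℝ, EuclideanSpace ℝ (Fin (n + 1))) X p) :
    fderiv ℝ (inChart X p) (extChartAt (𝓡 n) p p) =
      mfderiv (𝓡 n) 𝓘(ℝ, EuclideanSpace ℝ (Fin (n + 1))) X p := by
  refine (hX.mfderiv.trans ?_).symm
  rw [modelWithCornersSelf_coe, range_id, fderivWithin_univ]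
  rfl

lemma IsSmoothImmersion.injective_fderiv {X : M → EuclideanSpace ℝ (Fin (n + 1))}
    (hX : IsSmoothImmersion X) (p : M) :
    Function.Injective (fderiv ℝ (inChart X p) (extChartAt (𝓡 n) p p)) := by
  rw [fderiv_inChart X p (hX.contMDiff.mdifferentiable (by simp) p)]
  exact hX.injective_mfderiv p

lemma IsUnitNormal.inner_fderiv {X N : M → EuclideanSpace ℝ (Fin (n + 1))}
    (hX : IsSmoothImmersion X) (hN : IsUnitNormal X N) (p : M) (v : EuclideanSpace ℝ (Fin n)) :
    ⟪fderiv ℝ (inChart X p) (extChartAt (𝓡 n) p p) v, N p⟫ = 0 := by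
  rw [fderiv_inChart X p (hX.contMDiff.mdifferentiable (by simp) p)]
  exact hN.orthogonal p v

theorem weightedMeanCurvature_eq_lambdaFunction (hn : n ≠ 0)
    {X N : M → EuclideanSpace ℝ (Fin (n + 1))} (hX : IsSmoothImmersion X) (hN : IsUnitNormal X N)
    (X₀ : EuclideanSpace ℝ (Fin (n + 1))) (t₀ : ℝ) :
    weightedMeanCurvature X₀ t₀ X N = lambdaFunction X₀ t₀ X N := by
  ext p
  have hp : inChart X p (extChartAt (𝓡 n) p p) = X p := by simp [inChart]
  rw [weightedMeanCurvature, meanCurvature, normalizeField,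
    localMeanCurvature_conformalMetric hn _ _ _ _ _ _ (hN.inner_fderiv hX p)
      (hX.injective_fderiv p), hp, lambdaFunction, meanCurvature, conformalMetric_apply,
    real_inner_self_eq_norm_sq, hN.norm_eq_one, ← mul_assoc]
  have : √(Real.exp (-‖X p - X₀‖ ^ 2 / (n * t₀)) * 1 ^ 2) =
      Real.exp (-‖X p - X₀‖ ^ 2 / (2 * n * t₀)) := by
    rw [one_pow, mul_one, ← Real.exp_half]
    congr 1
    ring
  rw [this, mul_inv_cancel₀ (Real.exp_pos _).ne', one_mul]

end Hypersurface

/-- If the measures `μ i`, each carried by `U i`, agree on the overlaps of a countable cover, then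
their supremum restricts to each of them. -/
lemma restrict_iSup_measure {ι α : Type*} [MeasurableSpace α] (μ : ι → Measure α) (U : ι → Set α)
    (hU : ∀ i, MeasurableSet (U i)) (c : ℕ → ι) (hc : ⋃ k, U (c k) = univ)
    (hμ : ∀ i, (μ i).restrict (U i) = μ i)
    (hμU : ∀ i j, (μ i).restrict (U j) = (μ j).restrict (U i)) (i : ι) :
    (⨆ j, μ j).restrict (U i) = μ i := by
  set D := disjointed fun k => U (c k) with hD
  have hDm : ∀ k, MeasurableSet (D k) := fun k => MeasurableSet.disjointed (fun k => hU (c k)) k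
  have hDU : ∀ k, D k ⊆ U (c k) := fun k => disjointed_subset _ k
  -- The pieces glued along the disjointed cover form a measure that restricts to each μ j. It
  -- therefore dominates every μ j, hence the supremum, and this gives the upper bound below.
  have hν : ∀ j, (Measure.sum fun k => (μ (c k)).restrict (D k)).restrict (U j) = μ j := by
    intro j
    rw [Measure.restrict_sum _ (hU j)]
    have : ∀ k, ((μ (c k)).restrict (D k)).restrict (U j) = (μ j).restrict (D k) := by
      intro k
      rw [Measure.restrict_restrict (hU j), inter_comm, ← Measure.restrict_restrict (hDm k), hμU,
        Measure.restrict_restrict (hDm k), inter_eq_left.2 (hDU k)]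
    simp only [this]
    rw [← Measure.restrict_iUnion (disjoint_disjointed _) hDm, iUnion_disjointed, hc,
      Measure.restrict_univ]
  refine le_antisymm ?_ ?_
  · conv_rhs => rw [← hν i]
    refine Measure.restrict_mono le_rfl (iSup_le fun j => ?_)
    conv_lhs => rw [← hν j]
    exact Measure.restrict_le_self
  · conv_lhs => rw [← hμ i]
    exact Measure.restrict_mono le_rfl (le_iSup μ i)

lemma contDiff_det_gramMatrix {n m : ℕ} :
    ContDiff ℝ ∞ fun L : EuclideanSpace ℝ (Fin n) →L[ℝ] EuclideanSpace ℝ (Fin m) =>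
      (gramMatrix L).det := by
  simp only [Matrix.det_apply, gramMatrix_apply]
  refine ContDiff.sum fun σ _ => ContDiff.const_smul _ (contDiff_prod fun i _ => ?_)
  exact (contDiff_id.clm_apply contDiff_const).inner ℝ (contDiff_id.clm_apply contDiff_const)

lemma areaDensity_pos_iff {n m : ℕ} (Y : EuclideanSpace ℝ (Fin n) → EuclideanSpace ℝ (Fin m))
    (u : EuclideanSpace ℝ (Fin n)) :
    0 < areaDensity Y u ↔ Function.Injective (fderiv ℝ Y u) := by
  rw [areaDensity_eq, Real.sqrt_pos, gramMatrix_det_pos_iff]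

/-! ### The area measure of a single chart -/

section ChartMeasure

variable {n : ℕ} {M : Type*} [TopologicalSpace M] [ChartedSpace (EuclideanSpace ℝ (Fin n)) M]

lemma exists_seq_cover_chart [SecondCountableTopology M] [Nonempty M] :
    ∃ c : ℕ → M, ⋃ k, (extChartAt (𝓡 n) (c k)).source = univ := by
  obtain ⟨s, hs, hc⟩ := TopologicalSpace.countable_cover_nhds
    (fun p : M => extChartAt_source_mem_nhds (I := 𝓡 n) p)
  have hne : s.Nonempty := by
    rw [nonempty_iff_ne_empty]
    rintro rfl
    simp at hc
    exact empty_ne_univ hc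
  obtain ⟨c, rfl⟩ := hs.exists_eq_range hne
  exact ⟨c, by simpa using hc⟩

variable [MeasurableSpace M] [BorelSpace M]

lemma aemeasurable_extChartAt_symm (p : M) :
    AEMeasurable (extChartAt (𝓡 n) p).symm (volume.restrict (extChartAt (𝓡 n) p).target) :=
  (continuousOn_extChartAt_symm p).aemeasurable (isOpen_extChartAt_target p).measurableSet

lemma chartAreaMeasure_apply (X : M → EuclideanSpace ℝ (Fin (n + 1))) (p : M) {s : Set M}
    (hs : MeasurableSet s) :
    chartAreaMeasure X p s =
      ∫⁻ u in (extChartAt (𝓡 n) p).symm ⁻¹' s ∩ (extChartAt (𝓡 n) p).target,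
        ENNReal.ofReal (areaDensity (inChart X p) u) := by
  rw [chartAreaMeasure, Measure.map_apply_of_aemeasurable
    ((aemeasurable_extChartAt_symm p).mono_ac (withDensity_absolutelyContinuous _ _)) hs,
    withDensity_apply', Measure.restrict_restrict' (isOpen_extChartAt_target p).measurableSet]

/-- The inverse chart is controlled only on the target, where it is continuous, so measurability is
checked on that subtype and pushed forward. -/
lemma measurableSet_extChartAt_symm_preimage (p : M) {s : Set M} (hs : MeasurableSet s) :
    MeasurableSet ((extChartAt (𝓡 n) p).symm ⁻¹' s ∩ (extChartAt (𝓡 n) p).target) := by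
  have hm := (isOpen_extChartAt_target (I := 𝓡 n) p).measurableSet
  have h := (continuousOn_iff_continuous_domRestrict.1
    (continuousOn_extChartAt_symm (I := 𝓡 n) p)).measurable hs
  have := (MeasurableEmbedding.subtype_coe hm).measurableSet_image.2 h
  rwa [domRestrict_eq, preimage_comp, Subtype.image_preimage_coe, inter_comm] at this

lemma chartAreaMeasure_restrict_source (X : M → EuclideanSpace ℝ (Fin (n + 1))) (p : M) :
    (chartAreaMeasure X p).restrict (extChartAt (𝓡 n) p).source = chartAreaMeasure X p := by
  ext s hs
  have hU := (isOpen_extChartAt_source (I := 𝓡 n) p).measurableSet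
  rw [Measure.restrict_apply hs, chartAreaMeasure_apply _ _ (hs.inter hU),
    chartAreaMeasure_apply _ _ hs]
  congr 2
  ext u
  simp only [mem_inter_iff, mem_preimage]
  exact ⟨fun h => ⟨h.1.1, h.2⟩, fun h => ⟨⟨h.1, (extChartAt (𝓡 n) p).map_target h.2⟩, h.2⟩⟩

end ChartMeasure

/-! ### Changes of chart and the global area measure -/

section Charts

variable {n : ℕ} {M : Type*} [TopologicalSpace M] [ChartedSpace (EuclideanSpace ℝ (Fin n)) M]
  [IsManifold (𝓡 n) ∞ M]

lemma contDiffOn_inChart {X : M → EuclideanSpace ℝ (Fin (n + 1))}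
    (hX : ContMDiff (𝓡 n) 𝓘(ℝ, EuclideanSpace ℝ (Fin (n + 1))) ∞ X) (p : M) :
    ContDiffOn ℝ ∞ (inChart X p) (extChartAt (𝓡 n) p).target :=
  contMDiffOn_iff_contDiffOn.1 (hX.comp_contMDiffOn (contMDiffOn_extChartAt_symm p))

lemma differentiableAt_inChart {X : M → EuclideanSpace ℝ (Fin (n + 1))}
    (hX : ContMDiff (𝓡 n) 𝓘(ℝ, EuclideanSpace ℝ (Fin (n + 1))) ∞ X) {p : M}
    {u : EuclideanSpace ℝ (Fin n)} (hu : u ∈ (extChartAt (𝓡 n) p).target) :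
    DifferentiableAt ℝ (inChart X p) u :=
  ((contDiffOn_inChart hX p).contDiffAt ((isOpen_extChartAt_target p).mem_nhds hu)).differentiableAt
    (by simp)

/-- The change of coordinates from the chart at `p` to the chart at `q`. -/
def coordChange (p q : M) : EuclideanSpace ℝ (Fin n) → EuclideanSpace ℝ (Fin n) :=
  extChartAt (𝓡 n) q ∘ (extChartAt (𝓡 n) p).symm

lemma differentiableAt_coordChange {p q : M} {u : EuclideanSpace ℝ (Fin n)}
    (hu : u ∈ (extChartAt (𝓡 n) p).target)
    (hq : (extChartAt (𝓡 n) p).symm u ∈ (extChartAt (𝓡 n) q).source) :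
    DifferentiableAt ℝ (coordChange p q) u := by
  have h1 : ContMDiffAt 𝓘(ℝ, EuclideanSpace ℝ (Fin n)) (𝓡 n) ∞ (extChartAt (𝓡 n) p).symm u :=
    (contMDiffOn_extChartAt_symm p).contMDiffAt ((isOpen_extChartAt_target p).mem_nhds hu)
  have h2 : ContMDiffAt (𝓡 n) 𝓘(ℝ, EuclideanSpace ℝ (Fin n)) ∞ (extChartAt (𝓡 n) q)
      ((extChartAt (𝓡 n) p).symm u) :=
    contMDiffAt_extChartAt' (by rwa [extChartAt_source] at hq)
  exact (contMDiffAt_iff_contDiffAt.1 (h2.comp u h1)).differentiableAt (by simp)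

lemma fderiv_inChart_coordChange {X : M → EuclideanSpace ℝ (Fin (n + 1))}
    (hX : ContMDiff (𝓡 n) 𝓘(ℝ, EuclideanSpace ℝ (Fin (n + 1))) ∞ X) {p q : M}
    {u : EuclideanSpace ℝ (Fin n)} (hu : u ∈ (extChartAt (𝓡 n) p).target)
    (hq : (extChartAt (𝓡 n) p).symm u ∈ (extChartAt (𝓡 n) q).source) :
    fderiv ℝ (inChart X p) u =
      (fderiv ℝ (inChart X q) (coordChange p q u)).comp (fderiv ℝ (coordChange p q) u) := by
  rw [← fderiv_comp u (differentiableAt_inChart hX ((extChartAt (𝓡 n) q).map_source hq))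
    (differentiableAt_coordChange hu hq)]
  refine Filter.EventuallyEq.fderiv_eq ?_
  have hV : (extChartAt (𝓡 n) p).symm ⁻¹' (extChartAt (𝓡 n) q).source ∈ nhds u :=
    ((continuousOn_extChartAt_symm p).continuousAt
      ((isOpen_extChartAt_target p).mem_nhds hu)).preimage_mem_nhds
        ((isOpen_extChartAt_source q).mem_nhds hq)
  filter_upwards [hV] with v hv
  simp only [inChart, coordChange, Function.comp_apply]
  rw [(extChartAt (𝓡 n) q).left_inv hv]

lemma areaDensity_coordChange {X : M → EuclideanSpace ℝ (Fin (n + 1))}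
    (hX : ContMDiff (𝓡 n) 𝓘(ℝ, EuclideanSpace ℝ (Fin (n + 1))) ∞ X) {p q : M}
    {u : EuclideanSpace ℝ (Fin n)} (hu : u ∈ (extChartAt (𝓡 n) p).target)
    (hq : (extChartAt (𝓡 n) p).symm u ∈ (extChartAt (𝓡 n) q).source) :
    areaDensity (inChart X p) u =
      |(fderiv ℝ (coordChange p q) u).det| * areaDensity (inChart X q) (coordChange p q u) := by
  rw [areaDensity_eq, areaDensity_eq, fderiv_inChart_coordChange hX hu hq, gramMatrix_comp,
    Real.sqrt_mul (sq_nonneg _), Real.sqrt_sq_eq_abs]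

/-- Injectivity of the differential is read off in the chart centred at the point itself; the
transformation law carries positivity to any other chart. -/
lemma IsSmoothImmersion.areaDensity_pos {X : M → EuclideanSpace ℝ (Fin (n + 1))}
    (hX : IsSmoothImmersion X) {p : M} {u : EuclideanSpace ℝ (Fin n)}
    (hu : u ∈ (extChartAt (𝓡 n) p).target) : 0 < areaDensity (inChart X p) u := by
  set q := (extChartAt (𝓡 n) p).symm u with hq
  have h := areaDensity_coordChange hX.contMDiff (mem_extChartAt_target (I := 𝓡 n) q)
    (q := p) (by rw [extChartAt_to_inv]; exact (extChartAt (𝓡 n) p).map_target hu)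
  have e : coordChange q p (extChartAt (𝓡 n) q q) = u := by
    simp only [coordChange, Function.comp_apply, extChartAt_to_inv]
    exact (extChartAt (𝓡 n) p).right_inv hu
  rw [e] at h
  have h0 := (areaDensity_pos_iff _ _).2 (hX.injective_fderiv q)
  rw [h] at h0
  exact pos_of_mul_pos_right h0 (abs_nonneg _)

lemma continuousOn_areaDensity {X : M → EuclideanSpace ℝ (Fin (n + 1))}
    (hX : ContMDiff (𝓡 n) 𝓘(ℝ, EuclideanSpace ℝ (Fin (n + 1))) ∞ X) (p : M) :
    ContinuousOn (areaDensity (inChart X p)) (extChartAt (𝓡 n) p).target :=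
  (contDiff_det_gramMatrix.continuous.sqrt).comp_continuousOn
    ((contDiffOn_inChart hX p).continuousOn_fderiv_of_isOpen (isOpen_extChartAt_target p) (by simp))

/-- The ratio at `p` of the area densities of `Y` and `X`. -/
def areaRatio (X Y : M → EuclideanSpace ℝ (Fin (n + 1))) (p : M) : ℝ :=
  areaDensity (inChart Y p) (extChartAt (𝓡 n) p p) /
    areaDensity (inChart X p) (extChartAt (𝓡 n) p p)

/-- The Jacobian of the coordinate change multiplies both densities and cancels, so the ratio can be
computed in any chart. -/
lemma areaRatio_eq {X Y : M → EuclideanSpace ℝ (Fin (n + 1))} (hX : IsSmoothImmersion X)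
    (hY : ContMDiff (𝓡 n) 𝓘(ℝ, EuclideanSpace ℝ (Fin (n + 1))) ∞ Y) {p : M}
    {u : EuclideanSpace ℝ (Fin n)} (hu : u ∈ (extChartAt (𝓡 n) p).target) :
    areaRatio X Y ((extChartAt (𝓡 n) p).symm u) =
      areaDensity (inChart Y p) u / areaDensity (inChart X p) u := by
  have hq := mem_extChartAt_source (I := 𝓡 n) ((extChartAt (𝓡 n) p).symm u)
  have h0 := hX.areaDensity_pos hu
  rw [areaDensity_coordChange hX.contMDiff hu hq] at h0 ⊢
  rw [areaDensity_coordChange hY hu hq]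
  have := left_ne_zero_of_mul h0.ne'
  rw [mul_div_mul_left _ _ this]
  rfl

variable [MeasurableSpace M] [BorelSpace M]

/-- The coordinate change maps one chart's copy of the set bijectively onto the other's, so this is
the change of variables formula combined with `areaDensity_coordChange`. -/
lemma chartAreaMeasure_compatible {X : M → EuclideanSpace ℝ (Fin (n + 1))}
    (hX : ContMDiff (𝓡 n) 𝓘(ℝ, EuclideanSpace ℝ (Fin (n + 1))) ∞ X) (p q : M) :
    (chartAreaMeasure X p).restrict (extChartAt (𝓡 n) q).source =
      (chartAreaMeasure X q).restrict (extChartAt (𝓡 n) p).source := by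
  ext s hs
  have hU := fun p => (isOpen_extChartAt_source (I := 𝓡 n) (M := M) p).measurableSet
  rw [Measure.restrict_apply hs, Measure.restrict_apply hs,
    chartAreaMeasure_apply _ _ (hs.inter (hU q)), chartAreaMeasure_apply _ _ (hs.inter (hU p))]
  set a := (extChartAt (𝓡 n) p).symm ⁻¹' (s ∩ (extChartAt (𝓡 n) q).source) ∩
    (extChartAt (𝓡 n) p).target with ha
  have hb : (extChartAt (𝓡 n) q).symm ⁻¹' (s ∩ (extChartAt (𝓡 n) p).source) ∩
      (extChartAt (𝓡 n) q).target = coordChange p q '' a := by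
    ext v
    constructor
    · rintro ⟨⟨h1, h2⟩, h3⟩
      refine ⟨coordChange q p v, ⟨?_, ?_⟩, ?_⟩
      · simp only [coordChange, Function.comp_apply, mem_preimage]
        rw [(extChartAt (𝓡 n) p).left_inv h2]
        exact ⟨h1, (extChartAt (𝓡 n) q).map_target h3⟩
      · exact (extChartAt (𝓡 n) p).map_source h2
      · simp only [coordChange, Function.comp_apply]
        rw [(extChartAt (𝓡 n) p).left_inv h2, (extChartAt (𝓡 n) q).right_inv h3]
    · rintro ⟨u, ⟨⟨h1, h2⟩, h3⟩, rfl⟩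
      refine ⟨?_, (extChartAt (𝓡 n) q).map_source h2⟩
      simp only [coordChange, Function.comp_apply, mem_preimage]
      rw [(extChartAt (𝓡 n) q).left_inv h2]
      exact ⟨h1, (extChartAt (𝓡 n) p).map_target h3⟩
  have ham : MeasurableSet a := measurableSet_extChartAt_symm_preimage p (hs.inter (hU q))
  have hinj : InjOn (coordChange p q) a := by
    rintro u ⟨⟨-, h2⟩, h3⟩ v ⟨⟨-, h2'⟩, h3'⟩ huv
    exact (extChartAt (𝓡 n) p).symm.injOn h3 h3' ((extChartAt (𝓡 n) q).injOn h2 h2' huv)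
  rw [hb, lintegral_image_eq_lintegral_abs_det_fderiv_mul volume ham (fun u hu =>
    (differentiableAt_coordChange hu.2 hu.1.2).hasFDerivAt.hasFDerivWithinAt) hinj]
  refine setLIntegral_congr_fun ham fun u hu => ?_
  rw [← ENNReal.ofReal_mul (abs_nonneg _), areaDensity_coordChange hX hu.2 hu.1.2]

lemma lintegral_chartAreaMeasure {X : M → EuclideanSpace ℝ (Fin (n + 1))}
    (hX : ContMDiff (𝓡 n) 𝓘(ℝ, EuclideanSpace ℝ (Fin (n + 1))) ∞ X) (p : M) {f : M → ENNReal}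
    (hf : Measurable f) :
    ∫⁻ q, f q ∂chartAreaMeasure X p =
      ∫⁻ u in (extChartAt (𝓡 n) p).target, ENNReal.ofReal (areaDensity (inChart X p) u) *
        f ((extChartAt (𝓡 n) p).symm u) := by
  have hm := (isOpen_extChartAt_target (I := 𝓡 n) p).measurableSet
  have hs := aemeasurable_extChartAt_symm (n := n) p
  rw [chartAreaMeasure, lintegral_map' hf.aemeasurable
    (hs.mono_ac (withDensity_absolutelyContinuous _ _)),
    lintegral_withDensity_eq_lintegral_mul₀
      ((continuousOn_areaDensity hX p).aemeasurable hm).ennreal_ofReal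
      (show AEMeasurable (fun u => f ((extChartAt (𝓡 n) p).symm u)) _ from
        hf.comp_aemeasurable hs)]
  rfl

variable [SecondCountableTopology M] [Nonempty M]

lemma areaMeasure_restrict_source {X : M → EuclideanSpace ℝ (Fin (n + 1))}
    (hX : ContMDiff (𝓡 n) 𝓘(ℝ, EuclideanSpace ℝ (Fin (n + 1))) ∞ X) (p : M) :
    (areaMeasure X).restrict (extChartAt (𝓡 n) p).source = chartAreaMeasure X p := by
  obtain ⟨c, hc⟩ := exists_seq_cover_chart (n := n) (M := M)
  exact restrict_iSup_measure (chartAreaMeasure X) (fun p => (extChartAt (𝓡 n) p).source)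
    (fun p => (isOpen_extChartAt_source p).measurableSet) c hc
    (chartAreaMeasure_restrict_source X) (chartAreaMeasure_compatible hX) p

/-- The area measure of `Y` has density `areaRatio X Y` with respect to that of `X`. -/
theorem areaMeasure_eq_withDensity {X Y : M → EuclideanSpace ℝ (Fin (n + 1))}
    (hX : IsSmoothImmersion X)
    (hY : ContMDiff (𝓡 n) 𝓘(ℝ, EuclideanSpace ℝ (Fin (n + 1))) ∞ Y)
    (hXY : Measurable (areaRatio X Y)) :
    areaMeasure Y = (areaMeasure X).withDensity fun p => ENNReal.ofReal (areaRatio X Y p) := by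
  obtain ⟨c, hc⟩ := exists_seq_cover_chart (n := n) (M := M)
  refine Measure.ext_of_iUnion_eq_univ hc fun k => ?_
  set p := c k
  have hU := (isOpen_extChartAt_source (I := 𝓡 n) p).measurableSet
  rw [restrict_withDensity hU, areaMeasure_restrict_source hX.contMDiff,
    areaMeasure_restrict_source hY]
  ext s hs
  rw [withDensity_apply _ hs, ← lintegral_indicator hs, lintegral_chartAreaMeasure hX.contMDiff _
    (hXY.ennreal_ofReal.indicator hs), ← lintegral_indicator_one hs,
    lintegral_chartAreaMeasure hY _ (measurable_one.indicator hs)]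
  refine setLIntegral_congr_fun (isOpen_extChartAt_target p).measurableSet fun u hu => ?_
  by_cases h : (extChartAt (𝓡 n) p).symm u ∈ s
  · have h0 := hX.areaDensity_pos hu
    have h1 : areaDensity (inChart X p) u * areaRatio X Y ((extChartAt (𝓡 n) p).symm u) =
        areaDensity (inChart Y p) u := by
      rw [areaRatio_eq hX hY hu]
      field_simp
    rw [indicator_of_mem h, indicator_of_mem h, ← ENNReal.ofReal_mul h0.le, h1, Pi.one_apply,
      mul_one]
  · rw [indicator_of_notMem h, indicator_of_notMem h, mul_zero, mul_zero]

/-- Positivity on open sets upgrades almost everywhere equality of continuous functions to equality,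
and makes the total weighted area nonzero. -/
lemma areaMeasure_isOpenPosMeasure {X : M → EuclideanSpace ℝ (Fin (n + 1))}
    (hX : IsSmoothImmersion X) : (areaMeasure X).IsOpenPosMeasure := by
  refine ⟨fun U hU ⟨p, hp⟩ h0 => ?_⟩
  have h1 : chartAreaMeasure X p U = 0 := by
    rw [← areaMeasure_restrict_source hX.contMDiff, ← nonpos_iff_eq_zero, ← h0]
    exact Measure.restrict_apply_le _ _
  have hpos : ∀ u ∈ (extChartAt (𝓡 n) p).symm ⁻¹' U ∩ (extChartAt (𝓡 n) p).target,
      0 < areaDensity (inChart X p) u := fun u hu => hX.areaDensity_pos hu.2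
  have hopen : IsOpen ((extChartAt (𝓡 n) p).symm ⁻¹' U ∩ (extChartAt (𝓡 n) p).target) := by
    rw [inter_comm]
    exact (continuousOn_extChartAt_symm p).isOpen_inter_preimage (isOpen_extChartAt_target p) hU
  rw [chartAreaMeasure_apply _ _ hU.measurableSet, setLIntegral_eq_zero_iff' hopen.measurableSet
    ((((continuousOn_areaDensity hX.contMDiff p).mono inter_subset_right).aemeasurable
      hopen.measurableSet).ennreal_ofReal)] at h1
  have h2 : volume ((extChartAt (𝓡 n) p).symm ⁻¹' U ∩ (extChartAt (𝓡 n) p).target) = 0 := by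
    refine measure_mono_null (fun u hu => ?_) (ae_iff.1 h1)
    simp only [mem_ofPred_eq, Classical.not_imp, ENNReal.ofReal_eq_zero, not_le]
    exact ⟨hu, hpos u hu⟩
  refine (hopen.measure_pos volume ⟨extChartAt (𝓡 n) p p, ?_, mem_extChartAt_target p⟩).ne' h2
  simpa using hp

lemma areaMeasure_isLocallyFiniteMeasure
    {X : M → EuclideanSpace ℝ (Fin (n + 1))} (hX : IsSmoothImmersion X) :
    IsLocallyFiniteMeasure (areaMeasure X) := by
  refine ⟨fun p => ?_⟩
  obtain ⟨B, hB, hBt, hBc⟩ := local_compact_nhds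
    (extChartAt_target_mem_nhds (I := 𝓡 n) p)
  have hBm := hBc.measurableSet
  set S := (extChartAt (𝓡 n) p).source ∩ extChartAt (𝓡 n) p ⁻¹' interior B with hS
  have hSo : IsOpen S := (continuousOn_extChartAt p).isOpen_inter_preimage
    (isOpen_extChartAt_source p) isOpen_interior
  refine ⟨S, hSo.mem_nhds ⟨mem_extChartAt_source p, mem_interior_iff_mem_nhds.2 hB⟩, ?_⟩
  have h1 : areaMeasure X S = chartAreaMeasure X p S := by
    rw [← areaMeasure_restrict_source hX.contMDiff, Measure.restrict_apply hSo.measurableSet,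
      inter_eq_left.2 inter_subset_left]
  rw [h1, chartAreaMeasure_apply _ _ hSo.measurableSet]
  refine (lintegral_mono_set (t := B) ?_).trans_lt ?_
  · rintro u ⟨⟨-, h⟩, hu⟩
    rw [mem_preimage, (extChartAt (𝓡 n) p).right_inv hu] at h
    exact interior_subset h
  · obtain ⟨C, hC⟩ := (hBc.image_of_continuousOn
      ((continuousOn_areaDensity hX.contMDiff p).mono hBt)).bddAbove
    refine setLIntegral_lt_top_of_le_nnreal hBc.measure_lt_top.ne ⟨C.toNNReal, fun u hu => ?_⟩
    exact ENNReal.ofReal_le_ofReal (hC (mem_image_of_mem _ hu))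

end Charts

/-! ### Smooth one-parameter families and differentiation under the integral -/

section Families

variable {n : ℕ} {M : Type*} [TopologicalSpace M] [ChartedSpace (EuclideanSpace ℝ (Fin n)) M]
  {V : Type*} {J : Set ℝ}

/-- A family of functions on `M`, written in the chart at `p`. -/
def familyInChart (Φ : ℝ → M → V) (p : M) (z : ℝ × EuclideanSpace ℝ (Fin n)) : V :=
  Φ z.1 ((extChartAt (𝓡 n) p).symm z.2)

lemma familyInChart_extChartAt (Φ : ℝ → M → V) {p q : M}
    (hq : q ∈ (extChartAt (𝓡 n) p).source) (t : ℝ) :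
    familyInChart Φ p (t, extChartAt (𝓡 n) p q) = Φ t q := by
  rw [familyInChart, (extChartAt (𝓡 n) p).left_inv hq]

lemma isOpen_prod_target (hJ : IsOpen J) (p : M) :
    IsOpen (J ×ˢ (extChartAt (𝓡 n) p).target) :=
  hJ.prod (isOpen_extChartAt_target p)

lemma eventually_eq_familyInChart (Φ : ℝ → M → V) (t : ℝ) (p : M) :
    (fun z : ℝ × M => Φ z.1 z.2) =ᶠ[nhds (t, p)]
      fun z => familyInChart Φ p (z.1, extChartAt (𝓡 n) p z.2) := by
  filter_upwards [(continuous_snd.tendsto (t, p)).eventually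
    (extChartAt_source_mem_nhds (I := 𝓡 n) p)] with z hz
  exact (familyInChart_extChartAt Φ hz z.1).symm

lemma continuous_family {M : Type*} [TopologicalSpace M] [TopologicalSpace V] {Φ : ℝ → M → V}
    (hΦ : ContinuousOn (fun z : ℝ × M => Φ z.1 z.2) (J ×ˢ univ)) {t : ℝ} (ht : t ∈ J) :
    Continuous (Φ t) :=
  hΦ.comp_continuous (f := fun p => (t, p)) (by fun_prop) fun p => ⟨ht, mem_univ p⟩

lemma continuousOn_of_familyInChart [TopologicalSpace V] {Φ : ℝ → M → V} (hJ : IsOpen J)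
    (h : ∀ p, ContinuousOn (familyInChart Φ p) (J ×ˢ (extChartAt (𝓡 n) p).target)) :
    ContinuousOn (fun z : ℝ × M => Φ z.1 z.2) (J ×ˢ univ) := by
  rintro ⟨t, p⟩ ⟨ht, -⟩
  refine ContinuousAt.continuousWithinAt (ContinuousAt.congr ?_
    (eventually_eq_familyInChart (n := n) Φ t p).symm)
  have h1 : ContinuousAt (familyInChart Φ p) (t, extChartAt (𝓡 n) p p) :=
    (h p).continuousAt ((isOpen_prod_target hJ p).mem_nhds ⟨ht, mem_extChartAt_target p⟩)
  exact ContinuousAt.comp (f := fun z : ℝ × M => (z.1, extChartAt (𝓡 n) p z.2)) (x := (t, p)) h1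
    (continuousAt_fst.prodMk (ContinuousAt.comp (g := extChartAt (𝓡 n) p) (f := Prod.snd) (x := (t, p))
      (continuousAt_extChartAt p) continuousAt_snd))

variable [NormedAddCommGroup V] [NormedSpace ℝ V]

lemma contMDiff_family {Φ : ℝ → M → V}
    (hΦ : ContMDiffOn (𝓘(ℝ, ℝ).prod (𝓡 n)) 𝓘(ℝ, V) ∞ (fun z : ℝ × M => Φ z.1 z.2) (J ×ˢ univ))
    {t : ℝ} (ht : t ∈ J) : ContMDiff (𝓡 n) 𝓘(ℝ, V) ∞ (Φ t) :=
  hΦ.comp_contMDiff (f := fun p => (t, p)) (contMDiff_const.prodMk contMDiff_id)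
    fun p => ⟨ht, mem_univ p⟩

lemma contMDiffOn_of_familyInChart {Φ : ℝ → M → V} (hJ : IsOpen J)
    (h : ∀ p, ContDiffOn ℝ ∞ (familyInChart Φ p) (J ×ˢ (extChartAt (𝓡 n) p).target)) :
    ContMDiffOn (𝓘(ℝ, ℝ).prod (𝓡 n)) 𝓘(ℝ, V) ∞ (fun z : ℝ × M => Φ z.1 z.2) (J ×ˢ univ) := by
  rintro ⟨t, p⟩ ⟨ht, -⟩
  refine ContMDiffAt.contMDiffWithinAt (ContMDiffAt.congr_of_eventuallyEq ?_
    (eventually_eq_familyInChart (n := n) Φ t p))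
  have h1 : ContDiffAt ℝ ∞ (familyInChart Φ p) (t, extChartAt (𝓡 n) p p) :=
    (h p).contDiffAt ((isOpen_prod_target hJ p).mem_nhds ⟨ht, mem_extChartAt_target p⟩)
  have h2 : ContMDiffAt (𝓘(ℝ, ℝ).prod (𝓡 n)) 𝓘(ℝ, ℝ × EuclideanSpace ℝ (Fin n)) ∞
      (fun z : ℝ × M => (z.1, extChartAt (𝓡 n) p z.2)) (t, p) :=
    contMDiffAt_fst.prodMk_space
      (ContMDiffAt.comp (t, p) contMDiffAt_extChartAt contMDiffAt_snd)
  exact ContMDiffAt.comp (t, p) h1.contMDiffAt h2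

variable [IsManifold (𝓡 n) ∞ M]

lemma contDiffOn_familyInChart {Φ : ℝ → M → V}
    (hΦ : ContMDiffOn (𝓘(ℝ, ℝ).prod (𝓡 n)) 𝓘(ℝ, V) ∞ (fun z : ℝ × M => Φ z.1 z.2) (J ×ˢ univ))
    (p : M) : ContDiffOn ℝ ∞ (familyInChart Φ p) (J ×ˢ (extChartAt (𝓡 n) p).target) := by
  refine contMDiffOn_iff_contDiffOn.1 (hΦ.comp (t := J ×ˢ univ)
    (f := fun z : ℝ × EuclideanSpace ℝ (Fin n) => (z.1, (extChartAt (𝓡 n) p).symm z.2)) ?_ ?_)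
  · refine ContMDiffOn.prodMk contDiff_fst.contMDiff.contMDiffOn ?_
    exact (contMDiffOn_extChartAt_symm p).comp contDiff_snd.contMDiff.contMDiffOn fun z hz => hz.2
  · exact fun z hz => ⟨hz.1, mem_univ _⟩

lemma hasDerivAt_family {Φ : ℝ → M → V} (hJ : IsOpen J)
    (hΦ : ContMDiffOn (𝓘(ℝ, ℝ).prod (𝓡 n)) 𝓘(ℝ, V) ∞ (fun z : ℝ × M => Φ z.1 z.2) (J ×ˢ univ))
    (p : M) {t : ℝ} (ht : t ∈ J) {u : EuclideanSpace ℝ (Fin n)}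
    (hu : u ∈ (extChartAt (𝓡 n) p).target) :
    HasDerivAt (fun s => Φ s ((extChartAt (𝓡 n) p).symm u))
      (fderiv ℝ (familyInChart Φ p) (t, u) (1, 0)) t := by
  have h1 : HasFDerivAt (familyInChart Φ p) (fderiv ℝ (familyInChart Φ p) (t, u)) (t, u) :=
    (((contDiffOn_familyInChart hΦ p).contDiffAt
      ((isOpen_prod_target hJ p).mem_nhds ⟨ht, hu⟩)).differentiableAt (by simp)).hasFDerivAt
  exact HasFDerivAt.comp_hasDerivAt t (f := fun s => (s, u)) h1
    ((hasDerivAt_id t).prodMk (hasDerivAt_const t u))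

lemma differentiableAt_family {Φ : ℝ → M → V} (hJ : IsOpen J)
    (hΦ : ContMDiffOn (𝓘(ℝ, ℝ).prod (𝓡 n)) 𝓘(ℝ, V) ∞ (fun z : ℝ × M => Φ z.1 z.2) (J ×ˢ univ))
    (p : M) {t : ℝ} (ht : t ∈ J) : DifferentiableAt ℝ (fun s => Φ s p) t := by
  have := hasDerivAt_family hJ hΦ p ht (mem_extChartAt_target p)
  rw [extChartAt_to_inv] at this
  exact this.differentiableAt

lemma continuousOn_deriv_family {Φ : ℝ → M → V} (hJ : IsOpen J)
    (hΦ : ContMDiffOn (𝓘(ℝ, ℝ).prod (𝓡 n)) 𝓘(ℝ, V) ∞ (fun z : ℝ × M => Φ z.1 z.2) (J ×ˢ univ)) :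
    ContinuousOn (fun z : ℝ × M => deriv (fun s => Φ s z.2) z.1) (J ×ˢ univ) := by
  refine continuousOn_of_familyInChart (n := n) (Φ := fun t p => deriv (fun s => Φ s p) t) hJ
    fun p => ?_
  have h := (contDiffOn_familyInChart hΦ p).continuousOn_fderiv_of_isOpen
    (isOpen_prod_target hJ p) (by simp)
  refine (h.clm_apply (continuousOn_const (c := (1, 0)))).congr fun z hz => ?_
  exact (hasDerivAt_family hJ hΦ p hz.1 hz.2).deriv

/-- Differentiation under the integral sign, for a smooth family over a compact set. -/
lemma hasDerivAt_setIntegral_family [T2Space M] [MeasurableSpace M] [BorelSpace M] {μ : Measure M}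
    [IsLocallyFiniteMeasure μ] {Φ : ℝ → M → ℝ} (hJ : IsOpen J) {t : ℝ} (ht : t ∈ J)
    (hΦ : ContMDiffOn (𝓘(ℝ, ℝ).prod (𝓡 n)) 𝓘(ℝ, ℝ) ∞ (fun z : ℝ × M => Φ z.1 z.2) (J ×ˢ univ))
    {K : Set M} (hK : IsCompact K) :
    HasDerivAt (fun s => ∫ p in K, Φ s p ∂μ) (∫ p in K, deriv (fun s => Φ s p) t ∂μ) t := by
  obtain ⟨B, hB, hBJ, hBc⟩ := local_compact_nhds (hJ.mem_nhds ht)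
  have hcd := continuousOn_deriv_family hJ hΦ
  -- The time derivative is jointly continuous, so it is bounded on the compact set B × K; this
  -- constant is the dominating function.
  obtain ⟨C, hC⟩ := ((hBc.prod hK).image_of_continuousOn
    ((hcd.mono (prod_mono hBJ (subset_univ K))).norm)).bddAbove
  refine (hasDerivAt_integral_of_dominated_loc_of_deriv_le (bound := fun _ => C)
    (F' := fun s p => deriv (fun s => Φ s p) s) hB ?_ ?_ ?_ ?_ ?_ ?_).2
  · filter_upwards [hJ.mem_nhds ht] with s hs
    exact (continuous_family hΦ.continuousOn hs).aestronglyMeasurable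
  · exact (continuous_family hΦ.continuousOn ht).continuousOn.integrableOn_compact hK
  · exact (continuous_family (Φ := fun s p => deriv (fun s => Φ s p) s) hcd
      ht).aestronglyMeasurable
  · filter_upwards [ae_restrict_mem hK.measurableSet] with p hp s hs
    exact hC (mem_image_of_mem (fun z : ℝ × M => ‖deriv (fun s => Φ s z.2) z.1‖)
      (mk_mem_prod hs hp))
  · have : IsFiniteMeasure (μ.restrict K) := ⟨by simpa using hK.measure_lt_top⟩
    exact integrable_const C
  · exact Filter.Eventually.of_forall fun p s hs =>
      (differentiableAt_family hJ hΦ p (hBJ hs)).hasDerivAt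

/-! ### The area density of a family of hypersurfaces -/

variable {X N : M → EuclideanSpace ℝ (Fin (n + 1))} {F : ℝ → M → EuclideanSpace ℝ (Fin (n + 1))}

lemma fderiv_inChart_family (hJ : IsOpen J)
    (hF : ContMDiffOn (𝓘(ℝ, ℝ).prod (𝓡 n)) 𝓘(ℝ, EuclideanSpace ℝ (Fin (n + 1))) ∞
      (fun z : ℝ × M => F z.1 z.2) (J ×ˢ univ)) (p : M) {t : ℝ} (ht : t ∈ J)
    {u : EuclideanSpace ℝ (Fin n)} (hu : u ∈ (extChartAt (𝓡 n) p).target) :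
    fderiv ℝ (inChart (F t) p) u =
      (fderiv ℝ (familyInChart F p) (t, u)).comp
        (ContinuousLinearMap.inr ℝ ℝ (EuclideanSpace ℝ (Fin n))) := by
  have h1 : HasFDerivAt (familyInChart F p) (fderiv ℝ (familyInChart F p) (t, u)) (t, u) :=
    (((contDiffOn_familyInChart hF p).contDiffAt
      ((isOpen_prod_target hJ p).mem_nhds ⟨ht, hu⟩)).differentiableAt (by simp)).hasFDerivAt
  exact (HasFDerivAt.comp u (f := fun v => (t, v)) h1 (hasFDerivAt_prodMk_right t u)).fderiv

lemma familyInChart_areaRatio (hX : IsSmoothImmersion X) (hJ : IsOpen J)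
    (hF : ContMDiffOn (𝓘(ℝ, ℝ).prod (𝓡 n)) 𝓘(ℝ, EuclideanSpace ℝ (Fin (n + 1))) ∞
      (fun z : ℝ × M => F z.1 z.2) (J ×ˢ univ)) (p : M)
    {z : ℝ × EuclideanSpace ℝ (Fin n)} (hz : z ∈ J ×ˢ (extChartAt (𝓡 n) p).target) :
    familyInChart (fun t => areaRatio X (F t)) p z =
      √(gramMatrix ((fderiv ℝ (familyInChart F p) z).comp
        (ContinuousLinearMap.inr ℝ ℝ (EuclideanSpace ℝ (Fin n))))).det /
        areaDensity (inChart X p) z.2 := by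
  rw [familyInChart, areaRatio_eq hX (contMDiff_family hF hz.1) hz.2, areaDensity_eq (inChart _ p),
    fderiv_inChart_family hJ hF p hz.1 hz.2]

lemma contDiffOn_det_gramMatrix_family (hJ : IsOpen J)
    (hF : ContMDiffOn (𝓘(ℝ, ℝ).prod (𝓡 n)) 𝓘(ℝ, EuclideanSpace ℝ (Fin (n + 1))) ∞
      (fun z : ℝ × M => F z.1 z.2) (J ×ˢ univ)) (p : M) :
    ContDiffOn ℝ ∞ (fun z => (gramMatrix ((fderiv ℝ (familyInChart F p) z).comp
        (ContinuousLinearMap.inr ℝ ℝ (EuclideanSpace ℝ (Fin n))))).det)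
      (J ×ˢ (extChartAt (𝓡 n) p).target) :=
  contDiff_det_gramMatrix.comp_contDiffOn
    (((contDiffOn_familyInChart hF p).fderiv_of_isOpen (isOpen_prod_target hJ p)
      (by simp)).clm_comp contDiffOn_const)

/-- The square root is continuous even where the determinant vanishes, so the members of the family
need not be immersions. This is what allows immersivity for small t to be deduced in
`exists_isNormalVariation`. -/
lemma continuousOn_areaRatio_family (hX : IsSmoothImmersion X) (hJ : IsOpen J)
    (hF : ContMDiffOn (𝓘(ℝ, ℝ).prod (𝓡 n)) 𝓘(ℝ, EuclideanSpace ℝ (Fin (n + 1))) ∞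
      (fun z : ℝ × M => F z.1 z.2) (J ×ˢ univ)) :
    ContinuousOn (fun z : ℝ × M => areaRatio X (F z.1) z.2) (J ×ˢ univ) := by
  refine continuousOn_of_familyInChart (n := n) (Φ := fun t => areaRatio X (F t)) hJ fun p => ?_
  refine ContinuousOn.congr ?_ fun z hz => familyInChart_areaRatio hX hJ hF p hz
  refine ContinuousOn.div (contDiffOn_det_gramMatrix_family hJ hF p).continuousOn.sqrt
    ((continuousOn_areaDensity hX.contMDiff p).comp continuousOn_snd fun z hz => hz.2)
    fun z hz => (hX.areaDensity_pos hz.2).ne'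

lemma contDiffOn_areaDensity (hX : IsSmoothImmersion X) (p : M) :
    ContDiffOn ℝ ∞ (areaDensity (inChart X p)) (extChartAt (𝓡 n) p).target := by
  refine ContDiffOn.sqrt (contDiff_det_gramMatrix.comp_contDiffOn
    ((contDiffOn_inChart hX.contMDiff p).fderiv_of_isOpen (isOpen_extChartAt_target p) (by simp)))
    fun u hu => ?_
  exact (Real.sqrt_pos.1 (hX.areaDensity_pos hu)).ne'

/-- Immersivity keeps the determinant positive, where the square root is smooth. -/
lemma contMDiffOn_areaRatio_family (hX : IsSmoothImmersion X) (hJ : IsOpen J)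
    (hF : ContMDiffOn (𝓘(ℝ, ℝ).prod (𝓡 n)) 𝓘(ℝ, EuclideanSpace ℝ (Fin (n + 1))) ∞
      (fun z : ℝ × M => F z.1 z.2) (J ×ˢ univ)) (hFi : ∀ t ∈ J, IsSmoothImmersion (F t)) :
    ContMDiffOn (𝓘(ℝ, ℝ).prod (𝓡 n)) 𝓘(ℝ, ℝ) ∞
      (fun z : ℝ × M => areaRatio X (F z.1) z.2) (J ×ˢ univ) := by
  refine contMDiffOn_of_familyInChart (n := n) (Φ := fun t => areaRatio X (F t)) hJ fun p => ?_
  refine ContDiffOn.congr ?_ fun z hz => familyInChart_areaRatio hX hJ hF p hz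
  refine ContDiffOn.div ((contDiffOn_det_gramMatrix_family hJ hF p).sqrt fun z hz => ?_)
    ((contDiffOn_areaDensity hX p).comp contDiffOn_snd fun z hz => hz.2)
    fun z hz => (hX.areaDensity_pos hz.2).ne'
  have h := (hFi z.1 hz.1).areaDensity_pos hz.2
  rw [areaDensity_eq, fderiv_inChart_family hJ hF p hz.1 hz.2] at h
  exact (Real.sqrt_pos.1 h).ne'

lemma IsUnitNormal.inner_fderiv_inChart (hX : IsSmoothImmersion X) (hN : IsUnitNormal X N) {p : M}
    {u : EuclideanSpace ℝ (Fin n)} (hu : u ∈ (extChartAt (𝓡 n) p).target)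
    (v : EuclideanSpace ℝ (Fin n)) :
    ⟪fderiv ℝ (inChart X p) u v, N ((extChartAt (𝓡 n) p).symm u)⟫ = 0 := by
  rw [fderiv_inChart_coordChange hX.contMDiff hu (mem_extChartAt_source (I := 𝓡 n) _)]
  exact hN.inner_fderiv hX _ _

end Families

/-! ### First variation of weighted area and weighted volume -/

section FirstVariation

/-- The logarithmic derivative of the area density along a path of Gram matrices with normal
variation. -/
lemma hasDerivAt_sqrt_det_div {n : ℕ} {A : ℝ → Matrix (Fin n) (Fin n) ℝ}
    {h : Matrix (Fin n) (Fin n) ℝ} {t c : ℝ} (hpos : 0 < (A t).det)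
    (hsymm : (A t).transpose = A t)
    (hA : ∀ i j, HasDerivAt (fun s => A s i j) (-c * (h i j + h j i)) t) :
    HasDerivAt (fun s => √(A s).det / √(A t).det) (-c * ((A t)⁻¹ * h).trace) t := by
  have hd := ((hasDerivAt_det (A' := (-c) • (h + h.transpose)) hA).sqrt hpos.ne').div_const
    (√(A t).det)
  refine hd.congr_deriv ?_
  have hinv : (A t)⁻¹ = (A t).det⁻¹ • (A t).adjugate := by
    rw [Matrix.inv_def, Ring.inverse_eq_inv']
  -- Symmetry of A alone lets h and its transpose have the same trace against the adjugate, so h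
  -- need not be known to be symmetric.
  have htr : ((A t).adjugate * h.transpose).trace = ((A t).adjugate * h).trace := by
    rw [← Matrix.trace_transpose, Matrix.transpose_mul, Matrix.transpose_transpose,
      Matrix.adjugate_transpose, hsymm, Matrix.trace_mul_comm]
  rw [hinv, Matrix.mul_smul, Matrix.mul_add, Matrix.trace_smul, Matrix.trace_add, htr,
    Matrix.smul_mul, Matrix.trace_smul, div_div]
  have hs : 2 * √(A t).det * √(A t).det = 2 * (A t).det := by
    rw [mul_assoc, Real.mul_self_sqrt hpos.le]
  rw [hs, smul_eq_mul, smul_eq_mul]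
  field_simp
  ring

variable {n : ℕ} {M : Type*} [TopologicalSpace M] [ChartedSpace (EuclideanSpace ℝ (Fin n)) M]
  [IsManifold (𝓡 n) ∞ M] {J : Set ℝ}
  {X N : M → EuclideanSpace ℝ (Fin (n + 1))} {F : ℝ → M → EuclideanSpace ℝ (Fin (n + 1))}

/-- The first variation of the area density under a normal variation. -/
theorem hasDerivAt_areaRatio (hX : IsSmoothImmersion X) (hN : IsUnitNormal X N) (hJ : IsOpen J)
    (h0 : (0 : ℝ) ∈ J)
    (hF : ContMDiffOn (𝓘(ℝ, ℝ).prod (𝓡 n)) 𝓘(ℝ, EuclideanSpace ℝ (Fin (n + 1))) ∞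
      (fun z : ℝ × M => F z.1 z.2) (J ×ˢ univ)) (hF0 : F 0 = X) {f : M → ℝ}
    (hf : ∀ p, deriv (fun t => F t p) 0 = f p • N p) (p : M) :
    HasDerivAt (fun t => areaRatio X (F t) p) (-f p * meanCurvature euclideanMetric X N p) 0 := by
  set u₀ := extChartAt (𝓡 n) p p with hu₀
  have hu₀t : u₀ ∈ (extChartAt (𝓡 n) p).target := mem_extChartAt_target p
  set G := familyInChart (n := n) F p with hG
  have hGs : ContDiffAt ℝ ∞ G (0, u₀) := (contDiffOn_familyInChart hF p).contDiffAt
    ((isOpen_prod_target hJ p).mem_nhds ⟨h0, hu₀t⟩)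
  set D := fderiv ℝ (fderiv ℝ G) (0, u₀) with hD
  have hDd : HasFDerivAt (fderiv ℝ G) D (0, u₀) :=
    ((hGs.fderiv_right (m := ∞) (by simp)).differentiableAt (by simp)).hasFDerivAt
  have hsymm : ∀ v w, D v w = D w v := fun v w => (hGs.isSymmSndFDerivAt (by
    rw [minSmoothness_of_isRCLikeNormedField]; exact WithTop.coe_le_coe.2 le_top)) v w
  -- the derivatives of the family in the directions of `M`
  have hpart : ∀ t ∈ J, ∀ u ∈ (extChartAt (𝓡 n) p).target, ∀ v,
      fderiv ℝ (inChart (F t) p) u v = fderiv ℝ G (t, u) (0, v) := by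
    intro t ht u hu v
    rw [fderiv_inChart_family hJ hF p ht hu]
    rfl
  have hpart0 : ∀ u ∈ (extChartAt (𝓡 n) p).target, ∀ v,
      fderiv ℝ (inChart X p) u v = fderiv ℝ G (0, u) (0, v) := by
    intro u hu v
    rw [← hpart 0 h0 u hu, hF0]
  have hvar : ∀ u ∈ (extChartAt (𝓡 n) p).target,
      fderiv ℝ G (0, u) (1, 0) = f ((extChartAt (𝓡 n) p).symm u) •
        N ((extChartAt (𝓡 n) p).symm u) := by
    intro u hu
    rw [← hf, (hasDerivAt_family hJ hF p h0 hu).deriv]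
  have hnhds := (isOpen_extChartAt_target (I := 𝓡 n) p).mem_nhds hu₀t
  have hspace : ∀ w, HasFDerivAt (fun u => fderiv ℝ G (0, u) w)
      ((D.comp (ContinuousLinearMap.inr ℝ ℝ (EuclideanSpace ℝ (Fin n)))).flip w) u₀ := by
    intro w
    have h1 : HasFDerivAt (fun u => fderiv ℝ G (0, u))
        (D.comp (ContinuousLinearMap.inr ℝ ℝ (EuclideanSpace ℝ (Fin n)))) u₀ :=
      HasFDerivAt.comp u₀ (f := fun v => ((0 : ℝ), v)) hDd (hasFDerivAt_prodMk_right 0 u₀)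
    simpa using h1.clm_apply (hasFDerivAt_const w u₀)
  have htime : ∀ w, HasDerivAt (fun t => fderiv ℝ G (t, u₀) w) (D (1, 0) w) 0 := by
    intro w
    have h1 : HasDerivAt (fun t => fderiv ℝ G (t, u₀)) (D (1, 0)) 0 :=
      HasFDerivAt.comp_hasDerivAt (0 : ℝ) (f := fun s => (s, u₀)) hDd
        ((hasDerivAt_id 0).prodMk (hasDerivAt_const 0 u₀))
    simpa using h1.clm_apply (hasDerivAt_const (0 : ℝ) w)
  set e : Fin n → EuclideanSpace ℝ (Fin n) := fun i => EuclideanSpace.single i 1 with he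
  set h := secondFundamentalForm euclideanMetric (inChart X p) (N p) u₀ with hh
  have hhij : ∀ i j, h i j = ⟪D (0, e i) (0, e j), N p⟫ := by
    intro i j
    rw [hh, secondFundamentalForm_euclideanMetric, Matrix.of_apply]
    congr 1
    have h1 : partialDeriv (inChart X p) j =ᶠ[nhds u₀] fun u => fderiv ℝ G (0, u) (0, e j) := by
      filter_upwards [hnhds] with u hu
      exact hpart0 u hu (e j)
    rw [partialDeriv, h1.fderiv_eq, (hspace (0, e j)).fderiv]
    rfl
  -- At t = 0 the velocity is normal, so ⟨∂ₜF, ∂ⱼF⟩ vanishes identically in space. Differentiating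
  -- this in direction i and commuting the mixed derivatives gives ⟨∂ₜ∂ᵢF, ∂ⱼF⟩ = -f hᵢⱼ. Only F is
  -- differentiated, never f.
  have hkey : ∀ i j, ⟪D (1, 0) (0, e i), fderiv ℝ G (0, u₀) (0, e j)⟫ = -f p * h i j := by
    intro i j
    have hz : (fun u => ⟪fderiv ℝ G (0, u) (1, 0), fderiv ℝ G (0, u) (0, e j)⟫) =ᶠ[nhds u₀]
        fun _ => 0 := by
      filter_upwards [hnhds] with u hu
      rw [hvar u hu, ← hpart0 u hu, inner_smul_left, real_inner_comm,
        hN.inner_fderiv_inChart hX hu, mul_zero]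
    have h1 := ((hspace (1, 0)).inner ℝ (hspace (0, e j))).fderiv
    rw [hz.fderiv_eq, fderiv_const_apply] at h1
    have h2 := congrArg (fun L => L (e i)) h1
    have hW : fderiv ℝ G (0, u₀) (1, 0) = f p • N p := by
      rw [hvar u₀ hu₀t, hu₀, extChartAt_to_inv]
    simp [fderivInnerCLM_apply, hW, inner_smul_left] at h2
    rw [hsymm, hhij, real_inner_comm (N p)]
    linarith
  have hdet : ∀ t ∈ J, areaRatio X (F t) p =
      √(gramMatrix ((fderiv ℝ G (t, u₀)).comp
        (ContinuousLinearMap.inr ℝ ℝ (EuclideanSpace ℝ (Fin n))))).det /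
      √(gramMatrix ((fderiv ℝ G (0, u₀)).comp
        (ContinuousLinearMap.inr ℝ ℝ (EuclideanSpace ℝ (Fin n))))).det := by
    intro t ht
    rw [areaRatio, areaDensity_eq, areaDensity_eq, ← fderiv_inChart_family hJ hF p ht hu₀t,
      ← fderiv_inChart_family hJ hF p h0 hu₀t, hF0]
  have hg0 : gramMatrix ((fderiv ℝ G (0, u₀)).comp
        (ContinuousLinearMap.inr ℝ ℝ (EuclideanSpace ℝ (Fin n)))) =
      firstFundamentalForm euclideanMetric (inChart X p) u₀ := by
    rw [firstFundamentalForm_euclideanMetric, ← fderiv_inChart_family hJ hF p h0 hu₀t, hF0]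
  have hfinal := hasDerivAt_sqrt_det_div (t := 0) (c := f p) (h := h)
    (A := fun t => gramMatrix ((fderiv ℝ G (t, u₀)).comp
        (ContinuousLinearMap.inr ℝ ℝ (EuclideanSpace ℝ (Fin n)))))
    (by
      rw [hg0, firstFundamentalForm_euclideanMetric, gramMatrix_det_pos_iff]
      exact hX.injective_fderiv p)
    (gramMatrix_transpose _)
    (by
      intro i j
      have h1 := (htime (0, e i)).inner ℝ (htime (0, e j))
      refine h1.congr_deriv ?_
      rw [hkey, real_inner_comm, hkey]
      ring)
  rw [hg0] at hfinal
  refine (hfinal.congr_of_eventuallyEq ?_).congr_deriv rfl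
  filter_upwards [hJ.mem_nhds h0] with t ht
  rw [hdet t ht, hg0]

variable [MeasurableSpace M] [BorelSpace M] [SecondCountableTopology M]

lemma weightedArea_eq [Nonempty M] (hX : IsSmoothImmersion X)
    {Y : M → EuclideanSpace ℝ (Fin (n + 1))}
    (hY : ContMDiff (𝓡 n) 𝓘(ℝ, EuclideanSpace ℝ (Fin (n + 1))) ∞ Y)
    (hXY : Measurable (areaRatio X Y)) (X₀ : EuclideanSpace ℝ (Fin (n + 1))) (t₀ : ℝ) {K : Set M}
    (hK : MeasurableSet K) :
    weightedArea X₀ t₀ Y K =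
      ∫ p in K, areaRatio X Y p * Real.exp (-‖Y p - X₀‖ ^ 2 / (2 * t₀)) ∂areaMeasure X := by
  have hnn : ∀ p, 0 ≤ areaRatio X Y p := fun p =>
    div_nonneg (Real.sqrt_nonneg _) (Real.sqrt_nonneg _)
  rw [weightedArea, areaMeasure_eq_withDensity hX hY hXY, restrict_withDensity hK]
  rw [integral_withDensity_eq_integral_toReal_smul hXY.ennreal_ofReal (by simp)]
  simp only [ENNReal.toReal_ofReal (hnn _), smul_eq_mul]

/-- The first variation formula for the weighted area. -/
theorem hasDerivAt_weightedArea [T2Space M] [Nonempty M] (hX : IsSmoothImmersion X)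
    (hN : IsUnitNormal X N) (X₀ : EuclideanSpace ℝ (Fin (n + 1))) (t₀ : ℝ)
    {ε : ℝ} {K : Set M} (hF : IsNormalVariation X N ε K F)
    {f : M → ℝ} (hf : ∀ p, deriv (fun t => F t p) 0 = f p • N p) :
    HasDerivAt (fun t => weightedArea X₀ t₀ (F t) K)
      (∫ p in K, -(f p * (lambdaFunction X₀ t₀ X N p * Real.exp (-‖X p - X₀‖ ^ 2 / (2 * t₀))))
        ∂areaMeasure X) 0 := by
  have hJ : IsOpen (Ioo (-ε) ε) := isOpen_Ioo
  have h0 : (0 : ℝ) ∈ Ioo (-ε) ε := ⟨neg_lt_zero.2 hF.pos, hF.pos⟩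
  have := areaMeasure_isLocallyFiniteMeasure hX
  have hw : ContMDiffOn (𝓘(ℝ, ℝ).prod (𝓡 n)) 𝓘(ℝ, ℝ) ∞
      (fun z : ℝ × M => Real.exp (-‖F z.1 z.2 - X₀‖ ^ 2 / (2 * t₀))) (Ioo (-ε) ε ×ˢ univ) := by
    have h1 : ContDiff ℝ ∞ fun x : EuclideanSpace ℝ (Fin (n + 1)) =>
        Real.exp (-‖x - X₀‖ ^ 2 / (2 * t₀)) :=
      ((((contDiff_id.sub contDiff_const).norm_sq ℝ).neg).div_const _).exp
    exact h1.contMDiff.comp_contMDiffOn hF.contMDiffOn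
  have hr := contMDiffOn_areaRatio_family hX hJ hF.contMDiffOn hF.immersion
  have hd := hasDerivAt_setIntegral_family (μ := areaMeasure X)
    (Φ := fun t p => areaRatio X (F t) p * Real.exp (-‖F t p - X₀‖ ^ 2 / (2 * t₀))) hJ h0
    (hr.mul hw) hF.isCompact
  refine (hd.congr_of_eventuallyEq ?_).congr_deriv ?_
  · filter_upwards [hJ.mem_nhds h0] with t ht
    exact weightedArea_eq hX (hF.immersion t ht).contMDiff
      (continuous_family (Φ := fun t => areaRatio X (F t)) hr.continuousOn ht).measurable
      X₀ t₀ hF.isCompact.measurableSet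
  · refine setIntegral_congr_fun hF.isCompact.measurableSet fun p _ => ?_
    have h1 := hasDerivAt_areaRatio hX hN hJ h0 hF.contMDiffOn hF.initial hf p
    have h2 : HasDerivAt (fun t => F t p) (f p • N p) 0 := by
      rw [← hf]
      exact (differentiableAt_family hJ hF.contMDiffOn p h0).hasDerivAt
    have h3 := (((h2.sub_const X₀).norm_sq).fun_neg.div_const (2 * t₀)).exp
    have h4 : areaRatio X (F 0) p = 1 := by
      rw [hF.initial, areaRatio]
      exact div_self (hX.areaDensity_pos (mem_extChartAt_target p)).ne'
    refine (h1.mul h3).deriv.trans ?_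
    rw [h4, hF.initial, lambdaFunction, inner_smul_left, inner_smul_right]
    simp only [conj_trivial]
    -- With division by zero equal to zero, both sides lose their t₀ terms and the formula persists.
    by_cases ht₀ : t₀ = 0
    · simp [ht₀]
    · field_simp
      ring

/-- The first variation formula for the weighted volume. -/
theorem hasDerivAt_weightedVolume [T2Space M] [Nonempty M] (hX : IsSmoothImmersion X)
    (hN : IsUnitNormal X N) (X₀ : EuclideanSpace ℝ (Fin (n + 1))) (t₀ : ℝ)
    {ε : ℝ} {K : Set M} (hF : IsNormalVariation X N ε K F)
    {f : M → ℝ} (hf : ∀ p, deriv (fun t => F t p) 0 = f p • N p) :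
    HasDerivAt (fun t => weightedVolume X₀ t₀ X N (F t) K)
      (∫ p in K, f p * Real.exp (-‖X p - X₀‖ ^ 2 / (2 * t₀)) ∂areaMeasure X) 0 := by
  have hJ : IsOpen (Ioo (-ε) ε) := isOpen_Ioo
  have h0 : (0 : ℝ) ∈ Ioo (-ε) ε := ⟨neg_lt_zero.2 hF.pos, hF.pos⟩
  have := areaMeasure_isLocallyFiniteMeasure hX
  have hΦ : ContMDiffOn (𝓘(ℝ, ℝ).prod (𝓡 n)) 𝓘(ℝ, ℝ) ∞
      (fun z : ℝ × M => ⟪F z.1 z.2 - X₀, N z.2⟫ * Real.exp (-‖X z.2 - X₀‖ ^ 2 / (2 * t₀)))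
      (Ioo (-ε) ε ×ˢ univ) := by
    have h1 : ContDiff ℝ ∞ fun x : EuclideanSpace ℝ (Fin (n + 1)) =>
        Real.exp (-‖x - X₀‖ ^ 2 / (2 * t₀)) :=
      ((((contDiff_id.sub contDiff_const).norm_sq ℝ).neg).div_const _).exp
    have h2 : ContDiff ℝ ∞
        fun x : EuclideanSpace ℝ (Fin (n + 1)) × EuclideanSpace ℝ (Fin (n + 1)) =>
          ⟪x.1 - X₀, x.2⟫ := (contDiff_fst.sub contDiff_const).inner ℝ contDiff_snd
    refine ContMDiffOn.mul (h2.contMDiff.comp_contMDiffOn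
      (hF.contMDiffOn.prodMk_space (hN.contMDiff.comp contMDiff_snd).contMDiffOn)) ?_
    exact (h1.contMDiff.comp (hX.contMDiff.comp contMDiff_snd)).contMDiffOn
  have hd := hasDerivAt_setIntegral_family (μ := areaMeasure X)
    (Φ := fun t p => ⟪F t p - X₀, N p⟫ * Real.exp (-‖X p - X₀‖ ^ 2 / (2 * t₀))) hJ h0
    hΦ hF.isCompact
  refine hd.congr_deriv (setIntegral_congr_fun hF.isCompact.measurableSet fun p _ => ?_)
  have h2 : HasDerivAt (fun t => F t p) (f p • N p) 0 := by
    rw [← hf]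
    exact (differentiableAt_family hJ hF.contMDiffOn p h0).hasDerivAt
  have h3 := ((h2.sub_const X₀).inner ℝ (hasDerivAt_const (0 : ℝ) (N p))).mul_const
    (Real.exp (-‖X p - X₀‖ ^ 2 / (2 * t₀)))
  refine h3.deriv.trans ?_
  simp [inner_smul_left, hN.norm_eq_one]

end FirstVariation

lemma deriv_add_mul_smul {V : Type*} [NormedAddCommGroup V] [NormedSpace ℝ V] (x v : V) (c : ℝ) :
    deriv (fun t : ℝ => x + (t * c) • v) 0 = c • v := by
  have h : HasDerivAt (fun t => x + (t * c) • v) ((1 * c) • v) 0 :=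
    (((hasDerivAt_id (0 : ℝ)).mul_const c).smul_const v).const_add x
  rw [h.deriv, one_mul]

/-! ### Constancy of Λ at critical points -/

section Critical

lemma continuous_weight {n : ℕ} {M : Type*} [TopologicalSpace M]
    [ChartedSpace (EuclideanSpace ℝ (Fin n)) M] {X : M → EuclideanSpace ℝ (Fin (n + 1))}
    (hX : IsSmoothImmersion X)
    (X₀ : EuclideanSpace ℝ (Fin (n + 1))) (t₀ : ℝ) :
    Continuous fun p => Real.exp (-‖X p - X₀‖ ^ 2 / (2 * t₀)) :=
  (((hX.contMDiff.continuous.sub continuous_const).norm.pow 2).neg.div_const _).rexp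

variable {n : ℕ} {M : Type*} [TopologicalSpace M] [ChartedSpace (EuclideanSpace ℝ (Fin n)) M]
  [IsManifold (𝓡 n) ∞ M] {X N : M → EuclideanSpace ℝ (Fin (n + 1))}

lemma areaRatio_self (hX : IsSmoothImmersion X) (p : M) : areaRatio X X p = 1 :=
  div_self (hX.areaDensity_pos (mem_extChartAt_target p)).ne'

/-- A smooth function `f` with compact support is the speed of a normal variation, affine in
time. -/
lemma exists_isNormalVariation (hX : IsSmoothImmersion X) (hN : IsUnitNormal X N) {f : M → ℝ}
    (hf : ContMDiff (𝓡 n) 𝓘(ℝ, ℝ) ∞ f) (hfc : HasCompactSupport f) :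
    ∃ ε, IsNormalVariation X N ε (tsupport f) fun t p => X p + (t * f p) • N p := by
  set F : ℝ → M → EuclideanSpace ℝ (Fin (n + 1)) := fun t p => X p + (t * f p) • N p with hF
  have hFs : ContMDiff (𝓘(ℝ, ℝ).prod (𝓡 n)) 𝓘(ℝ, EuclideanSpace ℝ (Fin (n + 1))) ∞
      (fun z : ℝ × M => F z.1 z.2) :=
    (hX.contMDiff.comp contMDiff_snd).add
      ((contMDiff_fst.mul (hf.comp contMDiff_snd)).smul (hN.contMDiff.comp contMDiff_snd))
  have hFt : ∀ t, ContMDiff (𝓡 n) 𝓘(ℝ, EuclideanSpace ℝ (Fin (n + 1))) ∞ (F t) := fun t =>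
    contMDiff_family (J := univ) hFs.contMDiffOn (mem_univ t)
  have hF0 : F 0 = X := by
    ext1 p
    simp [hF]
  have hcont := continuousOn_areaRatio_family hX isOpen_univ hFs.contMDiffOn
  rw [univ_prod_univ, continuousOn_univ] at hcont
  -- The ratio is 1 at t = 0 and jointly continuous, so compactness of the support gives one time
  -- interval valid at all its points.
  have hev : ∀ᶠ t in nhds (0 : ℝ), ∀ p ∈ tsupport f, 0 < areaRatio X (F t) p := by
    refine hfc.isCompact.eventually_forall_of_forall_eventually fun p _ => ?_
    refine (hcont.tendsto (0, p)).eventually (lt_mem_nhds ?_)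
    simp only [hF0, areaRatio_self hX, zero_lt_one]
  have hoff : ∀ t, ∀ p ∉ tsupport f, F t p = X p := fun t p hp => by
    simp [hF, image_eq_zero_of_notMem_tsupport hp]
  obtain ⟨ε, hε, hball⟩ := Metric.eventually_nhds_iff_ball.1 hev
  refine ⟨ε, hε, hFs.contMDiffOn, fun t ht => ⟨hFt t, fun p => ?_⟩, hF0, hfc.isCompact,
    fun t _ => hoff t, f, fun p => ?_⟩
  · by_cases hp : p ∈ tsupport f
    · have h1 := hball t (by rwa [Real.ball_eq_Ioo, zero_sub, zero_add]) p hp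
      have h2 : 0 < areaDensity (inChart (F t) p) (extChartAt (𝓡 n) p p) := by
        refine (Real.sqrt_nonneg _).lt_of_ne' fun h => ?_
        rw [areaRatio, areaDensity, h, zero_div] at h1
        exact h1.false
      rw [← fderiv_inChart _ p ((hFt t).mdifferentiable (by simp) p)]
      exact (areaDensity_pos_iff _ _).1 h2
    · have h1 : F t =ᶠ[nhds p] X := by
        filter_upwards [(isClosed_tsupport f).isOpen_compl.mem_nhds hp] with q hq
        exact hoff t q hq
      have h2 := fderiv_inChart _ p ((hFt t).mdifferentiable (by simp) p)
      have h3 : inChart (F t) p =ᶠ[nhds (extChartAt (𝓡 n) p p)] inChart X p := by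
        have := (continuousAt_extChartAt_symm (I := 𝓡 n) p).tendsto
        rw [extChartAt_to_inv] at this
        exact this.eventually h1
      rw [← h2, h3.fderiv_eq]
      exact hX.injective_fderiv p
  · exact deriv_add_mul_smul _ _ _

/-- `meanCurvature` is evaluated in a chart that changes with the point, so its continuity is not
visible from the definition. Here fH is recognized as minus the time derivative at 0 of the jointly
smooth area ratio; a speed equal to 1 near a point then yields continuity of H there. -/
lemma IsNormalVariation.continuous_mul_meanCurvature (hX : IsSmoothImmersion X)
    (hN : IsUnitNormal X N) {ε : ℝ} {K : Set M} {F : ℝ → M → EuclideanSpace ℝ (Fin (n + 1))}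
    (hF : IsNormalVariation X N ε K F) {f : M → ℝ}
    (hf : ∀ p, deriv (fun t => F t p) 0 = f p • N p) :
    Continuous fun p => f p * meanCurvature euclideanMetric X N p := by
  have h0 : (0 : ℝ) ∈ Ioo (-ε) ε := ⟨neg_lt_zero.2 hF.pos, hF.pos⟩
  have h1 := continuousOn_deriv_family (Φ := fun t => areaRatio X (F t)) isOpen_Ioo
    (contMDiffOn_areaRatio_family hX isOpen_Ioo hF.contMDiffOn hF.immersion)
  refine (continuous_family (Φ := fun t p => deriv (fun s => areaRatio X (F s) p) t) h1
    h0).fun_neg.congr fun p => ?_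
  rw [(hasDerivAt_areaRatio hX hN isOpen_Ioo h0 hF.contMDiffOn hF.initial hf p).deriv]
  ring

lemma continuous_meanCurvature [T2Space M] (hX : IsSmoothImmersion X) (hN : IsUnitNormal X N) :
    Continuous (meanCurvature euclideanMetric X N) := by
  rw [continuous_iff_continuousAt]
  intro p
  obtain ⟨g⟩ : Nonempty (SmoothBumpFunction (𝓡 n) p) := inferInstance
  obtain ⟨ε, hF⟩ := exists_isNormalVariation hX hN g.contMDiff g.hasCompactSupport
  refine (hF.continuous_mul_meanCurvature hX hN
    (fun q => deriv_add_mul_smul _ _ _)).continuousAt.congr ?_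
  filter_upwards [g.eventuallyEq_one] with q hq
  simp [hq]

lemma continuous_lambdaFunction [T2Space M] (hX : IsSmoothImmersion X) (hN : IsUnitNormal X N)
    (X₀ : EuclideanSpace ℝ (Fin (n + 1))) (t₀ : ℝ) : Continuous (lambdaFunction X₀ t₀ X N) := by
  have h1 := hX.contMDiff.continuous
  have h2 := hN.contMDiff.continuous
  exact Continuous.add (by fun_prop) (continuous_meanCurvature hX hN)

variable [SecondCountableTopology M] [Nonempty M] [MeasurableSpace M] [BorelSpace M]
  {X₀ : EuclideanSpace ℝ (Fin (n + 1))} {t₀ lam : ℝ}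

lemma IsLambdaHypersurface.eq_average (hX : IsSmoothImmersion X)
    (h : IsLambdaHypersurface X₀ t₀ lam X N)
    (hint : Integrable (fun p => Real.exp (-‖X p - X₀‖ ^ 2 / (2 * t₀))) (areaMeasure X)) :
    lam = (∫ p, lambdaFunction X₀ t₀ X N p * Real.exp (-‖X p - X₀‖ ^ 2 / (2 * t₀))
      ∂(areaMeasure X)) / weightedArea X₀ t₀ X univ := by
  have := areaMeasure_isOpenPosMeasure hX
  have : NeZero (areaMeasure X) :=
    ⟨fun h0 => (isOpen_univ.measure_pos (areaMeasure X) univ_nonempty).ne' (by simp [h0])⟩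
  simp only [h _]
  rw [integral_const_mul, weightedArea, Measure.restrict_univ,
    mul_div_cancel_right₀ _ (integral_exp_pos hint).ne']

variable [T2Space M]

theorem IsLambdaHypersurface.isCriticalForWeightedArea (hX : IsSmoothImmersion X)
    (hN : IsUnitNormal X N) (h : IsLambdaHypersurface X₀ t₀ lam X N) :
    IsCriticalForWeightedArea X₀ t₀ X N := by
  intro ε K F hF hV
  obtain ⟨f, hf⟩ := hF.normal
  have h1 := hasDerivAt_weightedVolume hX hN X₀ t₀ hF hf
  have h2 : (fun t => weightedVolume X₀ t₀ X N (F t) K) =ᶠ[nhds 0]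
      fun _ => weightedVolume X₀ t₀ X N (F 0) K := by
    filter_upwards [Ioo_mem_nhds (neg_lt_zero.2 hF.pos) hF.pos] with t ht
    exact hV t ht
  have h3 := h1.unique ((hasDerivAt_const (0 : ℝ) _).congr_of_eventuallyEq h2)
  refine (hasDerivAt_weightedArea hX hN X₀ t₀ hF hf).congr_deriv ?_
  have h4 : ∀ p, -(f p * (lambdaFunction X₀ t₀ X N p * Real.exp (-‖X p - X₀‖ ^ 2 / (2 * t₀)))) =
      -lam * (f p * Real.exp (-‖X p - X₀‖ ^ 2 / (2 * t₀))) := fun p => by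
    rw [h p]
    ring
  simp only [h4]
  rw [integral_const_mul, h3, mul_zero]

/-- Along X + tfN the weighted volume is its initial value plus t∫ fw dμ, hence constant when f has
weighted mean zero. The affine variation is therefore admissible as it stands. -/
lemma IsCriticalForWeightedArea.integral_eq_zero (hX : IsSmoothImmersion X)
    (hN : IsUnitNormal X N) (h : IsCriticalForWeightedArea X₀ t₀ X N) {f : M → ℝ}
    (hf : ContMDiff (𝓡 n) 𝓘(ℝ, ℝ) ∞ f) (hfc : HasCompactSupport f)
    (hf0 : ∫ p, f p * Real.exp (-‖X p - X₀‖ ^ 2 / (2 * t₀)) ∂areaMeasure X = 0) :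
    ∫ p, f p * (lambdaFunction X₀ t₀ X N p * Real.exp (-‖X p - X₀‖ ^ 2 / (2 * t₀)))
      ∂areaMeasure X = 0 := by
  have := areaMeasure_isLocallyFiniteMeasure hX
  obtain ⟨ε, hF⟩ := exists_isNormalVariation hX hN hf hfc
  have hw := continuous_weight hX X₀ t₀
  have hsupp : ∀ g : M → ℝ, ∫ p in tsupport f, f p * g p ∂areaMeasure X =
      ∫ p, f p * g p ∂areaMeasure X := fun g =>
    setIntegral_eq_integral_of_forall_compl_eq_zero fun p hp => by
      rw [image_eq_zero_of_notMem_tsupport hp, zero_mul]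
  have hV : PreservesWeightedVolume X₀ t₀ X N ε (tsupport f)
      fun t p => X p + (t * f p) • N p := by
    have key : ∀ t : ℝ, weightedVolume X₀ t₀ X N (fun p => X p + (t * f p) • N p) (tsupport f) =
        ∫ p in tsupport f, ⟪X p - X₀, N p⟫ * Real.exp (-‖X p - X₀‖ ^ 2 / (2 * t₀))
          ∂areaMeasure X := by
      intro t
      have h1 : ∀ p, ⟪X p + (t * f p) • N p - X₀, N p⟫ * Real.exp (-‖X p - X₀‖ ^ 2 / (2 * t₀)) =
          ⟪X p - X₀, N p⟫ * Real.exp (-‖X p - X₀‖ ^ 2 / (2 * t₀)) +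
            t * (f p * Real.exp (-‖X p - X₀‖ ^ 2 / (2 * t₀))) := by
        intro p
        rw [add_sub_right_comm, inner_add_left, inner_smul_left, real_inner_self_eq_norm_sq,
          hN.norm_eq_one]
        simp only [conj_trivial]
        ring
      rw [weightedVolume]
      simp only [h1]
      rw [integral_add, integral_const_mul, hsupp, hf0, mul_zero, add_zero]
      · exact (((hX.contMDiff.continuous.sub continuous_const).inner
          hN.contMDiff.continuous).mul hw).continuousOn.integrableOn_compact hfc.isCompact
      · exact ((hf.continuous.mul hw).const_smul t).continuousOn.integrableOn_compact hfc.isCompact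
    intro t _
    rw [key, key]
  have hfd : ∀ q, deriv (fun t : ℝ => X q + (t * f q) • N q) 0 = f q • N q := fun q =>
    deriv_add_mul_smul _ _ _
  have h1 := (hasDerivAt_weightedArea hX hN X₀ t₀ hF hfd).unique (h ε _ _ hF hV)
  rw [integral_neg, hsupp, neg_eq_zero] at h1
  exact h1

theorem IsCriticalForWeightedArea.exists_isLambdaHypersurface (hX : IsSmoothImmersion X)
    (hN : IsUnitNormal X N) (h : IsCriticalForWeightedArea X₀ t₀ X N) :
    ∃ lam, IsLambdaHypersurface X₀ t₀ lam X N := by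
  have := areaMeasure_isLocallyFiniteMeasure hX
  have := areaMeasure_isOpenPosMeasure hX
  have : LocallyCompactSpace M := ChartedSpace.locallyCompactSpace (EuclideanSpace ℝ (Fin n)) M
  set μ := areaMeasure X
  set w : M → ℝ := fun p => Real.exp (-‖X p - X₀‖ ^ 2 / (2 * t₀)) with hwdef
  set Λ := lambdaFunction X₀ t₀ X N with hΛdef
  have hw : Continuous w := continuous_weight hX X₀ t₀
  have hΛ : Continuous Λ := continuous_lambdaFunction hX hN X₀ t₀
  let p₀ : M := Classical.arbitrary M
  obtain ⟨b⟩ : Nonempty (SmoothBumpFunction (𝓡 n) p₀) := inferInstance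
  have hint : ∀ g v : M → ℝ, Continuous g → HasCompactSupport g → Continuous v →
      Integrable (fun p => g p * v p) μ := fun g v hg hgc hv =>
    (hg.mul hv).integrable_of_hasCompactSupport hgc.mul_right
  have hb : 0 < ∫ p, b p * w p ∂μ := by
    refine (b.continuous.mul hw).integral_pos_of_hasCompactSupport_nonneg_nonzero
      b.hasCompactSupport.mul_right (fun p => mul_nonneg b.nonneg (Real.exp_pos _).le)
      (x := p₀) ?_
    rw [b.eq_one, one_mul]
    exact (Real.exp_pos _).ne'
  -- Testing Λ = c against b leaves this as the only possible value of c.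
  set c := (∫ p, b p * (Λ p * w p) ∂μ) / ∫ p, b p * w p ∂μ with hc
  refine ⟨c, ?_⟩
  have hae : ∀ᵐ p ∂μ, (Λ p - c) * w p = 0 := by
    refine ae_eq_zero_of_integral_contMDiff_smul_eq_zero (𝓡 n)
      ((hΛ.sub continuous_const).mul hw).locallyIntegrable fun g hg hgc => ?_
    -- This multiple makes g - ab have weighted mean zero; the contribution of b to the resulting
    -- identity is exactly c∫ gw dμ.
    set a := (∫ p, g p * w p ∂μ) / ∫ p, b p * w p ∂μ with ha
    have hsplit : ∀ v : M → ℝ, Continuous v → ∫ p, (g p - a * b p) * v p ∂μ =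
        (∫ p, g p * v p ∂μ) - a * ∫ p, b p * v p ∂μ := by
      intro v hv
      rw [← integral_const_mul, ← integral_sub (hint g v hg.continuous hgc hv)
        ((hint b v b.continuous b.hasCompactSupport hv).const_mul a)]
      exact integral_congr_ae (Filter.Eventually.of_forall fun p => by ring)
    have h1 := h.integral_eq_zero hX hN (f := fun p => g p - a * b p)
      (hg.sub (contMDiff_const.mul b.contMDiff)) (hgc.sub b.hasCompactSupport.mul_left)
      (by rw [hsplit w hw, ha, div_mul_cancel₀ _ hb.ne', sub_self])
    rw [hsplit (fun p => Λ p * w p) (hΛ.mul hw)] at h1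
    have h2 : ∫ p, g p • ((Λ p - c) * w p) ∂μ =
        (∫ p, g p * (Λ p * w p) ∂μ) - c * ∫ p, g p * w p ∂μ := by
      rw [← integral_const_mul, ← integral_sub (hint g (fun p => Λ p * w p) hg.continuous hgc (hΛ.mul hw))
        ((hint g w hg.continuous hgc hw).const_mul c)]
      exact integral_congr_ae (Filter.Eventually.of_forall fun p => by
        simp only [smul_eq_mul]; ring)
    rw [h2, ← h1, ha, hc]
    ring
  have hall := (Continuous.ae_eq_iff_eq μ ((hΛ.sub continuous_const).mul hw)
    continuous_zero).1 hae
  intro p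
  have hp := congrFun hall p
  have hp' : (Λ p - c) * w p = 0 := hp
  exact sub_eq_zero.1 ((mul_eq_zero.1 hp').resolve_right (Real.exp_pos _).ne')

end Critical

end LambdaHypersurface

end

theorem theorem2p1 {n : ℕ} (hn : 1 ≤ n) {M : Type*} [TopologicalSpace M] [T2Space M]
    [SecondCountableTopology M] [Nonempty M] [ChartedSpace (EuclideanSpace ℝ (Fin n)) M]
    [IsManifold (𝓡 n) ∞ M] [MeasurableSpace M] [BorelSpace M]
    (X N : M → EuclideanSpace ℝ (Fin (n + 1)))
    (hX : LambdaHypersurface.IsSmoothImmersion X) (hN : LambdaHypersurface.IsUnitNormal X N)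
    (X₀ : EuclideanSpace ℝ (Fin (n + 1))) (t₀ : ℝ) (ht₀ : t₀ ≠ 0) :
    (∀ lam : ℝ, LambdaHypersurface.IsLambdaHypersurface X₀ t₀ lam X N ↔
      LambdaHypersurface.HasConstantWeightedMeanCurvature X₀ t₀ lam X N) ∧
    List.TFAE [
      ∃ lam : ℝ, LambdaHypersurface.IsLambdaHypersurface X₀ t₀ lam X N,
      LambdaHypersurface.IsCriticalForWeightedArea X₀ t₀ X N,
      ∃ lam : ℝ, LambdaHypersurface.HasConstantWeightedMeanCurvature X₀ t₀ lam X N] ∧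
    (∀ lam : ℝ, LambdaHypersurface.IsLambdaHypersurface X₀ t₀ lam X N →
      Integrable (fun p => Real.exp (-‖X p - X₀‖ ^ 2 / (2 * t₀)))
        (LambdaHypersurface.areaMeasure X) →
      lam = (∫ p, LambdaHypersurface.lambdaFunction X₀ t₀ X N p *
          Real.exp (-‖X p - X₀‖ ^ 2 / (2 * t₀)) ∂(LambdaHypersurface.areaMeasure X)) /
        LambdaHypersurface.weightedArea X₀ t₀ X univ) := by
  have hiff : ∀ lam : ℝ, LambdaHypersurface.IsLambdaHypersurface X₀ t₀ lam X N ↔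
      LambdaHypersurface.HasConstantWeightedMeanCurvature X₀ t₀ lam X N := by
    intro lam
    rw [LambdaHypersurface.HasConstantWeightedMeanCurvature,
      LambdaHypersurface.weightedMeanCurvature_eq_lambdaFunction (by omega) hX hN]
    rfl
  refine ⟨hiff, ?_, fun lam h hint => h.eq_average hX hint⟩
  tfae_have 1 → 2 := fun ⟨_, h⟩ => h.isCriticalForWeightedArea hX hN
  tfae_have 2 → 1 := fun h => h.exists_isLambdaHypersurface hX hN
  tfae_have 1 ↔ 3 := exists_congr hiff
  tfae_finish
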